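/- Let $(M,g,\mathbb Q)$ be a quaternionic contact (QC) manifold of dimension $4n+3$, $n\ge 1$: $H\subset TM$ is a distribution of codimension three, $g$ is a metric on $H$, $\mathbb Q$ is a bundle of $2$-spheres of endomorphisms of $H$, and around every point there are a contact form $\eta=(\eta_1,\eta_2,\eta_3)$ with $H=\bigcap_s\ker\eta_s$ and almost complex structures $I_1,I_2,I_3$ on $H$ with $I_s^2=-1$, $I_1I_2=-I_2I_1=I_3$, $\mathbb Q=\{aI_1+bI_2+cI_3: a^2+b^2+c^2=1\}$ and $2g(I_sX,Y)=d\eta_s(X,Y)$ for $X,Y\in H$, where $d\theta(X,Y)=X\theta(Y)-Y\theta(X)-\theta([X,Y])$. The Reeb vector fields $\xi_1,\xi_2,\xi_3$ of $\eta$ are determined by $$\eta_s(\xi_k)=\delta_{sk},\qquad d\eta_s(\xi_s,X)=0,\qquad d\eta_k(\xi_s,X)=-d\eta_s(\xi_k,X)\qquad (X\in H),$$ and if $n=1$ their existence is part of the definition of a QC manifold. Extend $g$ to $TM$ by $g(\xi_s,\xi_k)=\delta_{sk}$, $\xi_s\perp H$, let $\sharp:T^*M\to TM$ be the musical isomorphism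 of this metric, and extend $I_s$ by $I_s\xi_k=0$. For a cyclic permutation $(i,j,k)$ of $(1,2,3)$ let $\alpha_i$ be the connection $1$-form with $\alpha_i(X)=d\eta_k(\xi_j,X)$ for $X\in H$ (only its values on $H$ matter below). A smooth vector field $Q$ on $M$ is called a QC vector field if, for every local contact form $\eta$ as above, $\mathcal L_Q\eta=(\nu I+O)\cdot\eta$ for some smooth function $\nu$ and some smooth function $O$ with values in $so(3)$. Then a smooth vector field $Q$ is a QC vector field if and only if for every local contact form $\eta$ as above there are smooth functions $f_1,f_2,f_3$ on its domain such that for every cyclic permutation $(i,j,k)$ of $(1,2,3)$ $$Q=-\tfrac12\big(f_j\,I_i\alpha_k^\sharp-f_k\,I_i\alpha_j^\sharp-I_i(df_i)^\sharp\big)+\sum_{s=1}^3f_s\,\xi_s ,$$ $$f_j\,d\eta_i(\xi_j,\xi_i)+f_k\,d\eta_i(\xi_k,\xi_i)+\xi_if_i=f_k\,d\eta_j(\xi_k,\xi_j)+f_i\,d\eta_j(\xi_i,\xi_j)+\xi_jf_j ,$$ $$f_i\,d\eta_i(\xi_i,\xi_j)+f_k\,d\eta_i(\xi_k,\xi_j)+\xi_jf_i=-f_j\,d\eta_j(\xi_j,\xi_i)-f_k\,d\eta_j(\xi_k,\xi_i)-\xi_if_j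 ,$$ $$f_j\,I_i\alpha_k^\sharp-f_k\,I_i\alpha_j^\sharp-I_i(df_i)^\sharp=f_i\,I_k\alpha_j^\sharp-f_j\,I_k\alpha_i^\sharp-I_k(df_k)^\sharp .$$ Moreover, whenever $Q$ has the form in the first of these equations (at a point, for one $i$), then $f_s=\eta_s(Q)$ there for $s=1,2,3$. -/

import Mathlib

open scoped Manifold ContDiff
open Set

noncomputable section

namespace QC

/-- The model space `ℝ^(4n+3)`. -/
abbrev Model (n : ℕ) : Type := EuclideanSpace ℝ (Fin (4 * n + 3))

section Calculus

variable {n : ℕ} {M : Type*} [TopologicalSpace M] [ChartedSpace (Model n) M]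
  [IsManifold 𝓘(ℝ, Model n) ∞ M]

/-- The tangent space `T_p M`. -/
abbrev T (n : ℕ) {M : Type*} [TopologicalSpace M] [ChartedSpace (Model n) M] (p : M) : Type :=
  TangentSpace 𝓘(ℝ, Model n) p

/-- A vector field is smooth on `W`. -/
def SmoothFieldOn (X : ∀ p : M, T n p) (W : Set M) : Prop :=
  ContMDiffOn 𝓘(ℝ, Model n) 𝓘(ℝ, Model n).tangent ∞
    (fun p => (⟨p, X p⟩ : TangentBundle 𝓘(ℝ, Model n) M)) W

/-- A `1`-form (a section of the cotangent bundle) is smooth on `W`. -/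
def SmoothFormOn (θ : ∀ p : M, T n p →L[ℝ] ℝ) (W : Set M) : Prop :=
  ContMDiffOn 𝓘(ℝ, Model n) (𝓘(ℝ, Model n).prod 𝓘(ℝ, Model n →L[ℝ] ℝ)) ∞
    (fun p => Bundle.TotalSpace.mk' (Model n →L[ℝ] ℝ)
      (E := fun p : M => T n p →L[ℝ] Bundle.Trivial M ℝ p) p (θ p)) W

/-- A real function is smooth on `W`. -/
def SmoothFunOn (f : M → ℝ) (W : Set M) : Prop :=
  ContMDiffOn 𝓘(ℝ, Model n) 𝓘(ℝ, ℝ) ∞ f W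

/-- The differential `df_p` of a real function. -/
def dfun (f : M → ℝ) (p : M) : T n p →L[ℝ] ℝ :=
  mfderiv 𝓘(ℝ, Model n) 𝓘(ℝ, ℝ) f p

/-- The differential at `p` of the preferred chart at `p`. -/
def dchart (p : M) : T n p →L[ℝ] Model n :=
  mfderiv 𝓘(ℝ, Model n) 𝓘(ℝ, Model n) (extChartAt 𝓘(ℝ, Model n) p) p

/-- The `1`-form `θ` written in the preferred chart at `p`, that is, its pullback under the
inverse of this chart. -/
def formInChart (θ : ∀ p : M, T n p →L[ℝ] ℝ) (p : M) (x : Model n) : Model n →L[ℝ] ℝ :=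
  (θ ((extChartAt 𝓘(ℝ, Model n) p).symm x)).comp
    (mfderiv 𝓘(ℝ, Model n) 𝓘(ℝ, Model n) (extChartAt 𝓘(ℝ, Model n) p).symm x)

/-- The vector field `X` written in the preferred chart at `p`, that is, its push-forward under
this chart. -/
def fieldInChart (X : ∀ p : M, T n p) (p : M) (x : Model n) : Model n :=
  mfderiv 𝓘(ℝ, Model n) 𝓘(ℝ, Model n) (extChartAt 𝓘(ℝ, Model n) p)
    ((extChartAt 𝓘(ℝ, Model n) p).symm x) (X ((extChartAt 𝓘(ℝ, Model n) p).symm x))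

/-- The exterior derivative of a `1`-form, normalised by
`dθ(X, Y) = X θ(Y) - Y θ(X) - θ([X, Y])`; in coordinates `(dθ)_{ab} = ∂_a θ_b - ∂_b θ_a`. -/
def extD (θ : ∀ p : M, T n p →L[ℝ] ℝ) (p : M) :
    LinearMap.BilinForm ℝ (T n p) :=
  let D := fderiv ℝ (formInChart θ p) (extChartAt 𝓘(ℝ, Model n) p p)
  (D - D.flip).toLinearMap₁₂.compl₁₂ (dchart (n := n) p : T n p →ₗ[ℝ] Model n)
    (dchart (n := n) p : T n p →ₗ[ℝ] Model n)

/-- The Lie derivative of a `1`-form, `(L_Q θ)(X) = Q θ(X) - θ([Q, X])`; in coordinates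
`(L_Q θ)_a = Q^b ∂_b θ_a + θ_b ∂_a Q^b`. -/
def lieD (Q : ∀ p : M, T n p) (θ : ∀ p : M, T n p →L[ℝ] ℝ) (p : M) : T n p →L[ℝ] ℝ :=
  let x := extChartAt 𝓘(ℝ, Model n) p p
  (fderiv ℝ (formInChart θ p) x (fieldInChart Q p x)
    + (formInChart θ p x).comp (fderiv ℝ (fieldInChart Q p) x)).comp (dchart p)

end Calculus

variable {n : ℕ} {M : Type*} [TopologicalSpace M] [ChartedSpace (Model n) M]
  [IsManifold 𝓘(ℝ, Model n) ∞ M]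

/-- The pointwise data `(H, g, ℚ)`: a codimension three distribution `H`, a smooth metric `g` on
`H`, and for every point a set `ℚ` of endomorphisms of `H`. -/
structure Data (n : ℕ) (M : Type*) [TopologicalSpace M] [ChartedSpace (Model n) M]
    [IsManifold 𝓘(ℝ, Model n) ∞ M] where
  H : ∀ p : M, Submodule ℝ (T n p)
  finrank_H : ∀ p, Module.finrank ℝ (H p) = 4 * n
  g : ∀ p : M, LinearMap.BilinForm ℝ (H p)
  g_symm : ∀ p X Y, g p X Y = g p Y X
  g_pos : ∀ p X, X ≠ 0 → 0 < g p X X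
  g_smooth : ∀ W : Set M, IsOpen W → ∀ X Y : ∀ p, H p,
    SmoothFieldOn (fun p => (X p : T n p)) W → SmoothFieldOn (fun p => (Y p : T n p)) W →
    SmoothFunOn (n := n) (fun p => g p (X p) (Y p)) W
  Qs : ∀ p : M, Set (H p →ₗ[ℝ] H p)

/-- A local contact form `η = (η₁, η₂, η₃)` associated with `(H, g, ℚ)` on an open set `U`,
together with its almost complex structures `I₁, I₂, I₃` on `H`. The indices `1, 2, 3` are
`0, 1, 2 : Fin 3`. -/
structure Data.ContactForm (S : Data n M) where
  U : Set M
  isOpen_U : IsOpen U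
  η : Fin 3 → ∀ p : M, T n p →L[ℝ] ℝ
  η_smooth : ∀ s, SmoothFormOn (η s) U
  mem_H : ∀ p ∈ U, ∀ v : T n p, v ∈ S.H p ↔ ∀ s, η s p v = 0
  I : Fin 3 → ∀ p : M, S.H p →ₗ[ℝ] S.H p
  I_smooth : ∀ s, ∀ W ⊆ U, IsOpen W → ∀ X : ∀ p, S.H p,
    SmoothFieldOn (fun p => (X p : T n p)) W → SmoothFieldOn (fun p => (I s p (X p) : T n p)) W
  I_sq : ∀ s, ∀ p ∈ U, I s p ∘ₗ I s p = -LinearMap.id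
  I_mul : ∀ p ∈ U, I 0 p ∘ₗ I 1 p = I 2 p
  I_mul' : ∀ p ∈ U, I 1 p ∘ₗ I 0 p = -I 2 p
  Qs_eq : ∀ p ∈ U, S.Qs p =
    {J | ∃ a b c : ℝ, a ^ 2 + b ^ 2 + c ^ 2 = 1 ∧ J = a • I 0 p + b • I 1 p + c • I 2 p}
  compat : ∀ s, ∀ p ∈ U, ∀ X Y : S.H p,
    2 * S.g p (I s p X) Y = extD (η s) p (X : T n p) (Y : T n p)

variable {S : Data n M}

/-- The Reeb vector fields `ξ₁, ξ₂, ξ₃` of a local contact form. They are uniquely determined by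
these conditions on `U`, and hence smooth there: `ξ_s` is the unique solution of the first two
conditions, a smooth linear system. -/
structure Data.ContactForm.Reeb (F : S.ContactForm) where
  ξ : Fin 3 → ∀ p : M, T n p
  η_ξ : ∀ p ∈ F.U, ∀ s k, F.η s p (ξ k p) = if s = k then 1 else 0
  d_self : ∀ p ∈ F.U, ∀ s, ∀ X : S.H p, extD (F.η s) p (ξ s p) (X : T n p) = 0
  d_skew : ∀ p ∈ F.U, ∀ s k, ∀ X : S.H p,
    extD (F.η k) p (ξ s p) (X : T n p) = -extD (F.η s) p (ξ k p) (X : T n p)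

/-- A quaternionic contact manifold `(M, g, ℚ)` of dimension `4n+3`. In dimension seven the
existence of the Reeb vector fields is part of the definition. -/
structure Structure (n : ℕ) (M : Type*) [TopologicalSpace M] [ChartedSpace (Model n) M]
    [IsManifold 𝓘(ℝ, Model n) ∞ M] extends Data n M where
  exists_contactForm : ∀ p : M, ∃ F : toData.ContactForm, p ∈ F.U
  exists_reeb : n = 1 → ∀ F : toData.ContactForm, Nonempty F.Reeb

/-- `Q` is a QC vector field: for every local contact form `η` one has `L_Q η = (ν I + O) η`
with a smooth function `ν` and a smooth `so(3)`-valued function `O`. -/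
def Structure.IsQCVectorField (S : Structure n M) (Q : ∀ p : M, T n p) : Prop :=
  ∀ F : S.ContactForm, ∃ (ν : M → ℝ) (O : M → Matrix (Fin 3) (Fin 3) ℝ),
    SmoothFunOn (n := n) ν F.U ∧ (∀ i s, SmoothFunOn (n := n) (fun p => O p i s) F.U) ∧
    ∀ p ∈ F.U, O p ∈ LieAlgebra.Orthogonal.so (Fin 3) ℝ ∧
      ∀ i, lieD Q (F.η i) p = ν p • F.η i p + ∑ s, O p i s • F.η s p

namespace Data.ContactForm.Reeb

variable {F : S.ContactForm} (R : F.Reeb) {p : M} (hp : p ∈ F.U)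

/-- The projection of `T_p M = H ⊕ V` onto `H`, where `V = span {ξ₁, ξ₂, ξ₃}`. -/
def hor : T n p →ₗ[ℝ] S.H p :=
  LinearMap.codRestrict (S.H p)
    (LinearMap.id - ∑ s, (F.η s p : T n p →ₗ[ℝ] ℝ).smulRight (R.ξ s p))
    (fun v => by
      rw [F.mem_H p hp]
      intro s
      simp [R.η_ξ p hp])

/-- The endomorphism `I_s` of `H` extended to `T_p M` by `0` on `V`. -/
def Iext (s : Fin 3) : T n p →ₗ[ℝ] T n p :=
  (S.H p).subtype ∘ₗ F.I s p ∘ₗ R.hor hp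

/-- The extension of `g` to a metric on `T_p M` for which `V ⊥ H` and `g(ξ_s, ξ_k) = δ_sk`. -/
def gext : LinearMap.BilinForm ℝ (T n p) :=
  (S.g p).compl₁₂ (R.hor hp) (R.hor hp)
    + ∑ s, LinearMap.BilinForm.linMulLin (F.η s p : T n p →ₗ[ℝ] ℝ) (F.η s p : T n p →ₗ[ℝ] ℝ)

theorem gext_apply (v w : T n p) :
    R.gext hp v w = S.g p (R.hor hp v) (R.hor hp w) + ∑ s, F.η s p v * F.η s p w := by
  simp [gext, LinearMap.sum_apply]

theorem gext_self_eq_zero {v : T n p} (h : R.gext hp v v = 0) : v = 0 := by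
  rw [gext_apply] at h
  have h1 : 0 ≤ S.g p (R.hor hp v) (R.hor hp v) := by
    by_cases hv : R.hor hp v = 0
    · simp [hv]
    · exact (S.g_pos p _ hv).le
  have h2 : ∀ s ∈ Finset.univ, 0 ≤ F.η s p v * F.η s p v := fun s _ => mul_self_nonneg _
  have h3 : ∑ s, F.η s p v * F.η s p v = 0 := by
    have := Finset.sum_nonneg h2
    linarith
  have h4 : ∀ s, F.η s p v = 0 := fun s =>
    mul_self_eq_zero.1 ((Finset.sum_eq_zero_iff_of_nonneg h2).1 h3 s (Finset.mem_univ s))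
  have h5 : R.hor hp v = 0 := by
    by_contra hv
    have := S.g_pos p _ hv
    linarith
  have h6 : ((R.hor hp v : S.H p) : T n p) = v := by
    simp [hor, h4]
  rw [← h6, h5]
  rfl

theorem gext_nondegenerate : (R.gext hp).Nondegenerate :=
  ⟨fun v hv => R.gext_self_eq_zero hp (hv v), fun v hv => R.gext_self_eq_zero hp (hv v)⟩

/-- The musical isomorphism `♯ : T_p^* M → T_p M` of the extended metric:
`g(θ^♯, w) = θ(w)` for all `w`. -/
def sharp (θ : Module.Dual ℝ (T n p)) : T n p :=
  have : FiniteDimensional ℝ (T n p) := inferInstanceAs (FiniteDimensional ℝ (Model n))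
  ((R.gext hp).toDual (R.gext_nondegenerate hp)).symm θ

/-- The connection `1`-form `α_i`, `α_i(X) = dη_k(ξ_j, X)` for `X ∈ H` and `(i, j, k)` a cyclic
permutation of `(1, 2, 3)`, extended by `0` on `V`. -/
def α (i : Fin 3) : Module.Dual ℝ (T n p) :=
  extD (F.η (i + 2)) p (R.ξ (i + 1) p) ∘ₗ (S.H p).subtype ∘ₗ R.hor hp

/-- The vector field
`f_j I_i α_k^♯ - f_k I_i α_j^♯ - I_i (df_i)^♯`, where `(i, j, k) = (i, i + 1, i + 2)`. -/
def hamiltonian (f : Fin 3 → M → ℝ) (i : Fin 3) : T n p :=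
  f (i + 1) p • R.Iext hp i (R.sharp hp (R.α hp (i + 2)))
    - f (i + 2) p • R.Iext hp i (R.sharp hp (R.α hp (i + 1)))
    - R.Iext hp i (R.sharp hp (dfun (n := n) (f i) p : T n p →ₗ[ℝ] ℝ))

end Data.ContactForm.Reeb

end QC

end

/-!
The theorem rests on Cartan's formula `L_Q η_i = d(η_i(Q)) + ι_Q dη_i` (`QC.lieD_apply`). If `Q`
has the displayed form at a point, then, the term with `I_i` being horizontal, applying `η_s` gives
`f_s = η_s(Q)` (`eq_η_of_eq_hamiltonian`). So let `f_s = η_s(Q)` and split the QC condition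
according to `T_p M = H ⊕ span {ξ₁, ξ₂, ξ₃}`.

* On `H` it says that `L_Q η_i` vanishes. As `dη_i = 2 g(I_i ·, ·)` is nondegenerate on `H`, this
  determines the horizontal part of `Q` and amounts to the displayed form of `Q`, for each `i`
  (`eq_hamiltonian_iff`).
* On the Reeb fields it says that the matrix `(L_Q η_i)(ξ_s)` is a multiple of the identity plus a
  skew matrix. Since `dη_i(ξ_i, ·)` and `dη_i(ξ_j, ·) + dη_j(ξ_i, ·)` vanish on `H`, only the
  values of `dη_i` on pairs of Reeb fields enter the relevant combinations (`extD_apply_ξ_self`,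
  `extD_apply_ξ_add`), which yields the two scalar equations (`equations_iff`).

Conversely `ν` and `O` are read off from this matrix. Its entries are smooth because `L_Q η_i`
annihilates `H`: the Reeb fields may then be replaced by any smooth local frame dual to `η`
(`exists_dualFrame`, `smooth_lieD_ξ`).

The right-hand side of the equivalence speaks about the Reeb fields, so to return from it to the
QC condition one needs to know that they exist. For `n = 1` this is part of the definition; for
`n ≥ 2` it is a theorem of Biquard, proved here as `nonempty_reeb`. Nondegeneracy provides `ξ_s`
dual to `η_s` with `dη_s(ξ_s, H) = 0`. What remains is `γ_i = 0` on `H`, where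
`γ_i(X) = dη_{i+2}(ξ_{i+1}, X) + dη_{i+1}(ξ_{i+2}, X)` (`skewDefect`). On `H ⊗ ℂ` the form
`ω = dη_{i+1} + √-1 dη_{i+2}` has type `(2, 0)` for `I_i`, so it kills all vectors
`X + √-1 I_i X`. Evaluating `dω = 0` on three such fields therefore leaves only the vertical parts
of their brackets, and its real part says that the cyclic sum of
`dη_{i+1}(X, Y) γ_i(I_i Z) - dη_{i+2}(X, Y) γ_i(Z)` vanishes (`cyclic_identity`). If `4n > 4`,
there is `X ≠ 0` orthogonal to `Z, I_1 Z, I_2 Z, I_3 Z`, and the choice `Y = I_{i+2} X` reduces the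
identity to `g(X, X) γ_i(Z) = 0` (`skewDefect_eq_zero`).
-/

noncomputable section

namespace QC

open VectorField Filter Topology Bundle

variable {n : ℕ} {M : Type*} [TopologicalSpace M] [ChartedSpace (Model n) M]
  [IsManifold 𝓘(ℝ, Model n) ∞ M]

/-! ### Charts and smoothness -/

section
variable {W : Set M} {p : M} {θ : ∀ p : M, T n p →L[ℝ] ℝ} {X Y Z : ∀ p : M, T n p} {f : M → ℝ}

theorem SmoothFormOn.apply (hθ : SmoothFormOn θ W) (hX : SmoothFieldOn X W) :
    SmoothFunOn (n := n) (fun q => θ q (X q)) W := by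
  have h := ContMDiffOn.clm_bundle_apply (b := fun q : M => q) (F₁ := Model n) (F₂ := ℝ)
    (E₁ := fun q : M => T n q) (E₂ := Bundle.Trivial M ℝ) (ϕ := θ) (v := X) hθ hX
  intro q hq
  have := h q hq
  rw [contMDiffWithinAt_section] at this
  exact this

theorem SmoothFunOn.dfun_apply (hW : IsOpen W) (hf : SmoothFunOn (n := n) f W)
    (hX : SmoothFieldOn X W) : SmoothFunOn (n := n) (fun q => dfun (n := n) f q (X q)) W := by
  have h := (contMDiff_snd_tangentBundle_modelSpace ℝ 𝓘(ℝ, ℝ) (n := ∞)).comp_contMDiffOn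
    ((hf.contMDiffOn_tangentMapWithin (m := ∞) (by simp) hW.uniqueMDiffOn).comp hX
      (fun q hq => hq))
  refine h.congr fun q hq => ?_
  exact congrArg (fun L : T n q →L[ℝ] ℝ => L (X q)) (mfderivWithin_of_isOpen hW hq).symm

theorem range_modelWithCorners : range 𝓘(ℝ, Model n) = univ := by simp

/-- The differential at `q` of the preferred chart at `p`. -/
def chartD (p q : M) : T n q →L[ℝ] Model n :=
  mfderiv 𝓘(ℝ, Model n) 𝓘(ℝ, Model n) (extChartAt 𝓘(ℝ, Model n) p) q

/-- The differential at `y` of the inverse of the preferred chart at `p`. -/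
def chartS (p : M) (y : Model n) : Model n →L[ℝ] T n ((extChartAt 𝓘(ℝ, Model n) p).symm y) :=
  mfderiv 𝓘(ℝ, Model n) 𝓘(ℝ, Model n) (extChartAt 𝓘(ℝ, Model n) p).symm y

theorem chartS_chartD {y : Model n} (hy : y ∈ (extChartAt 𝓘(ℝ, Model n) p).target)
    (v : T n ((extChartAt 𝓘(ℝ, Model n) p).symm y)) :
    chartS p y (chartD p ((extChartAt 𝓘(ℝ, Model n) p).symm y) v) = v := by
  have h := mfderivWithin_extChartAt_symm_comp_mfderiv_extChartAt (I := 𝓘(ℝ, Model n)) hy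
  rw [range_modelWithCorners, mfderivWithin_univ] at h
  exact congrArg (fun L => L v) h

theorem chartD_chartS {y : Model n} (hy : y ∈ (extChartAt 𝓘(ℝ, Model n) p).target) (v : Model n) :
    chartD p ((extChartAt 𝓘(ℝ, Model n) p).symm y) (chartS p y v) = v := by
  have h := mfderiv_extChartAt_comp_mfderivWithin_extChartAt_symm (I := 𝓘(ℝ, Model n)) hy
  rw [range_modelWithCorners, mfderivWithin_univ] at h
  exact congrArg (fun L => L v) h

/-- Chain rule for the inverse chart, at points other than the centre of the chart too. -/
theorem dfun_symm {y : Model n} (hy : y ∈ (extChartAt 𝓘(ℝ, Model n) p).target)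
    (hf : MDifferentiableAt 𝓘(ℝ, Model n) 𝓘(ℝ, ℝ) f ((extChartAt 𝓘(ℝ, Model n) p).symm y))
    (v : T n ((extChartAt 𝓘(ℝ, Model n) p).symm y)) :
    dfun (n := n) f ((extChartAt 𝓘(ℝ, Model n) p).symm y) v =
      fderiv ℝ (f ∘ (extChartAt 𝓘(ℝ, Model n) p).symm) y
        (chartD p ((extChartAt 𝓘(ℝ, Model n) p).symm y) v) := by
  have hs :
      MDifferentiableAt 𝓘(ℝ, Model n) 𝓘(ℝ, Model n) (extChartAt 𝓘(ℝ, Model n) p).symm y := by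
    have := mdifferentiableWithinAt_extChartAt_symm (I := 𝓘(ℝ, Model n)) hy
    rwa [range_modelWithCorners, mdifferentiableWithinAt_univ] at this
  rw [← mfderiv_eq_fderiv]
  have h := mfderiv_comp_apply y hf hs
    (chartD p ((extChartAt 𝓘(ℝ, Model n) p).symm y) v)
  refine Eq.trans ?_ h.symm
  exact congrArg (fun w => dfun (n := n) f ((extChartAt 𝓘(ℝ, Model n) p).symm y) w)
    (chartS_chartD hy v).symm

theorem dchart_eq_id (p : M) (v : T n p) : dchart p v = v :=
  congrArg (fun L => L v) (mfderiv_extChartAt_self (I := 𝓘(ℝ, Model n)) (x := p))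

omit [IsManifold 𝓘(ℝ, Model n) ∞ M] in
theorem fieldInChart_center (X : ∀ p : M, T n p) (p : M) :
    fieldInChart X p (extChartAt 𝓘(ℝ, Model n) p p) = dchart p (X p) := by
  unfold fieldInChart
  rw [extChartAt_to_inv]
  rfl

theorem formInChart_fieldInChart {y : Model n} (hy : y ∈ (extChartAt 𝓘(ℝ, Model n) p).target) :
    formInChart θ p y (fieldInChart X p y) =
      θ ((extChartAt 𝓘(ℝ, Model n) p).symm y) (X ((extChartAt 𝓘(ℝ, Model n) p).symm y)) :=
  congrArg (θ _) (chartS_chartD hy _)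

/-- At the centre, a form and its expression in the chart agree. The tangent vector is extended to a
field so that the identity can be transported along `extChartAt_to_inv` without casts. -/
theorem formInChart_center (θ : ∀ p : M, T n p →L[ℝ] ℝ) (p : M) (v : T n p) :
    formInChart θ p (extChartAt 𝓘(ℝ, Model n) p p) (dchart p v) = θ p v := by
  classical
  let X : ∀ q : M, T n q := Function.update (fun _ => 0) p v
  have hX : X p = v := Function.update_self ..
  have h : ∀ q, q = p → θ q (X q) = θ p v := by rintro q rfl; rw [hX]
  rw [← h _ (extChartAt_to_inv (I := 𝓘(ℝ, Model n)) p),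
    ← formInChart_fieldInChart (mem_extChartAt_target p), fieldInChart_center, hX]

omit [IsManifold 𝓘(ℝ, Model n) ∞ M] in
theorem eventually_mem_target (p : M) :
    ∀ᶠ y in 𝓝 (extChartAt 𝓘(ℝ, Model n) p p), y ∈ (extChartAt 𝓘(ℝ, Model n) p).target :=
  (isOpen_extChartAt_target p).mem_nhds (mem_extChartAt_target p)

omit [IsManifold 𝓘(ℝ, Model n) ∞ M] in
theorem eventually_extChartAt_symm_mem (p : M) {W : Set M} (hW : IsOpen W) (hp : p ∈ W) :
    ∀ᶠ y in 𝓝 (extChartAt 𝓘(ℝ, Model n) p p), (extChartAt 𝓘(ℝ, Model n) p).symm y ∈ W := by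
  have := continuousAt_extChartAt_symm (I := 𝓘(ℝ, Model n)) p
  apply this
  rw [extChartAt_to_inv]
  exact hW.mem_nhds hp

omit [IsManifold 𝓘(ℝ, Model n) ∞ M] in
theorem SmoothFunOn.contDiffAt (hW : IsOpen W) (hp : p ∈ W) (hf : SmoothFunOn (n := n) f W) :
    ContDiffAt ℝ ∞ (f ∘ (extChartAt 𝓘(ℝ, Model n) p).symm) (extChartAt 𝓘(ℝ, Model n) p p) := by
  have h := (contMDiffAt_iff.1 (hf.contMDiffAt (hW.mem_nhds hp))).2
  rw [range_modelWithCorners, contDiffWithinAt_univ] at h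
  exact h

/-- The push-forward of `X` under the chart is its pullback under the inverse chart, which is the
expression of `X` that enters the definition of `mlieBracket`. -/
theorem fieldInChart_eq {y : Model n} (hy : y ∈ (extChartAt 𝓘(ℝ, Model n) p).target) :
    mpullbackWithin 𝓘(ℝ, Model n) 𝓘(ℝ, Model n) (extChartAt 𝓘(ℝ, Model n) p).symm X
      (range 𝓘(ℝ, Model n)) y = fieldInChart X p y := by
  rw [mpullbackWithin_apply, range_modelWithCorners, mfderivWithin_univ]
  have h : (mfderiv 𝓘(ℝ, Model n) 𝓘(ℝ, Model n) (extChartAt 𝓘(ℝ, Model n) p).symm y).inverse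
     = chartD p ((extChartAt 𝓘(ℝ, Model n) p).symm y) :=
    ContinuousLinearMap.inverse_eq
      (ContinuousLinearMap.ext fun v => chartS_chartD hy v)
      (ContinuousLinearMap.ext fun v => chartD_chartS hy v)
  rw [h]
  rfl

theorem SmoothFieldOn.differentiableAt (hW : IsOpen W) (hp : p ∈ W) (hX : SmoothFieldOn X W) :
    DifferentiableAt ℝ (fieldInChart X p) (extChartAt 𝓘(ℝ, Model n) p p) := by
  have h := (hX.contMDiffAt (hW.mem_nhds hp)).mdifferentiableAt (by simp)
  have := MDifferentiableWithinAt.differentiableWithinAt_mpullbackWithin_vectorField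
    (mdifferentiableWithinAt_univ.2 h)
  rw [preimage_univ, univ_inter] at this
  have h2 : DifferentiableWithinAt ℝ (fieldInChart X p) (range 𝓘(ℝ, Model n))
      (extChartAt 𝓘(ℝ, Model n) p p) := by
    refine DifferentiableWithinAt.congr_of_eventuallyEq this ?_ ?_
    · filter_upwards [nhdsWithin_le_nhds (eventually_mem_target p)] with y hy
      exact (fieldInChart_eq hy).symm
    · exact (fieldInChart_eq (mem_extChartAt_target p)).symm
  rwa [range_modelWithCorners, differentiableWithinAt_univ] at h2

theorem dfun_eq_fderiv (hf : MDifferentiableAt 𝓘(ℝ, Model n) 𝓘(ℝ, ℝ) f p) (v : T n p) :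
    dfun (n := n) f p v = fderiv ℝ (f ∘ (extChartAt 𝓘(ℝ, Model n) p).symm)
      (extChartAt 𝓘(ℝ, Model n) p p) (dchart p v) := by
  have h : dfun (n := n) f p = fderivWithin ℝ (f ∘ (extChartAt 𝓘(ℝ, Model n) p).symm)
      (range 𝓘(ℝ, Model n)) (extChartAt 𝓘(ℝ, Model n) p p) := by
    unfold dfun mfderiv
    exact if_pos hf
  rw [dchart_eq_id, h, range_modelWithCorners, fderivWithin_univ]
  rfl

/-- The Lie bracket on `M` is the Lie bracket of the expressions in the chart. -/
theorem dchart_mlieBracket (X Y : ∀ p : M, T n p) (p : M) :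
    dchart p (mlieBracket 𝓘(ℝ, Model n) X Y p) =
      lieBracket ℝ (fieldInChart X p) (fieldInChart Y p) (extChartAt 𝓘(ℝ, Model n) p p) := by
  have h1 : mlieBracket 𝓘(ℝ, Model n) X Y p = lieBracketWithin ℝ
      (mpullbackWithin 𝓘(ℝ, Model n) 𝓘(ℝ, Model n) (extChartAt 𝓘(ℝ, Model n) p).symm X
        (range 𝓘(ℝ, Model n)))
      (mpullbackWithin 𝓘(ℝ, Model n) 𝓘(ℝ, Model n) (extChartAt 𝓘(ℝ, Model n) p).symm Y
        (range 𝓘(ℝ, Model n)))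
      ((extChartAt 𝓘(ℝ, Model n) p).symm ⁻¹' univ ∩ range 𝓘(ℝ, Model n))
      (extChartAt 𝓘(ℝ, Model n) p p) := by
    refine Eq.trans (congrArg (fun L : T n p →L[ℝ] T n p => L.inverse _)
      (mfderiv_extChartAt_self (I := 𝓘(ℝ, Model n)) (x := p))) ?_
    rw [ContinuousLinearMap.inverse_id]
    rfl
  rw [dchart_eq_id, h1, preimage_univ, univ_inter]
  have h2 := fun X : ∀ p : M, T n p =>
    (eventually_mem_target p).mono fun y hy => fieldInChart_eq (X := X) hy
  have h3 : ∀ V W : Model n → Model n, ∀ s x, s = univ →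
      lieBracketWithin ℝ V W s x = lieBracket ℝ V W x := by
    rintro V W s x rfl; rw [lieBracketWithin_univ]
  exact (h3 _ _ _ _ range_modelWithCorners).trans
    (Filter.EventuallyEq.lieBracket_vectorField_eq (h2 X) (h2 Y))

theorem dfun_field_eventuallyEq (hW : IsOpen W) (hp : p ∈ W) (hf : SmoothFunOn (n := n) f W)
    (X : ∀ p : M, T n p) :
    (fun q => dfun (n := n) f q (X q)) ∘ (extChartAt 𝓘(ℝ, Model n) p).symm
      =ᶠ[𝓝 (extChartAt 𝓘(ℝ, Model n) p p)]
    fun y => fderiv ℝ (f ∘ (extChartAt 𝓘(ℝ, Model n) p).symm) y (fieldInChart X p y) := by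
  filter_upwards [eventually_mem_target p, eventually_extChartAt_symm_mem p hW hp] with y hy hyW
  exact dfun_symm hy ((hf.contMDiffAt (hW.mem_nhds hyW)).mdifferentiableAt (by simp)) _

omit [IsManifold 𝓘(ℝ, Model n) ∞ M] in
theorem SmoothFunOn.mdifferentiableAt (hW : IsOpen W) (hp : p ∈ W) (hf : SmoothFunOn (n := n) f W) :
    MDifferentiableAt 𝓘(ℝ, Model n) 𝓘(ℝ, ℝ) f p :=
  (hf.contMDiffAt (hW.mem_nhds hp)).mdifferentiableAt (by simp)

/-- `[X, Y] f = X (Y f) - Y (X f)`. -/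
theorem dfun_mlieBracket (hW : IsOpen W) (hp : p ∈ W) (hf : SmoothFunOn (n := n) f W)
    (hX : SmoothFieldOn X W) (hY : SmoothFieldOn Y W) :
    dfun (n := n) f p (mlieBracket 𝓘(ℝ, Model n) X Y p) =
      dfun (n := n) (fun q => dfun (n := n) f q (Y q)) p (X p) -
      dfun (n := n) (fun q => dfun (n := n) f q (X q)) p (Y p) := by
  rw [dfun_eq_fderiv (hf.mdifferentiableAt hW hp), dchart_mlieBracket,
    dfun_eq_fderiv ((hf.dfun_apply hW hY).mdifferentiableAt hW hp),
    dfun_eq_fderiv ((hf.dfun_apply hW hX).mdifferentiableAt hW hp),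
    (dfun_field_eventuallyEq hW hp hf Y).fderiv_eq, (dfun_field_eventuallyEq hW hp hf X).fderiv_eq,
    ← fieldInChart_center, ← fieldInChart_center]
  exact fderiv_apply_lieBracket (hf.contDiffAt hW hp)
    (by rw [minSmoothness_of_isRCLikeNormedField]; exact ENat.LEInfty.out)
    (hY.differentiableAt hW hp) (hX.differentiableAt hW hp)

theorem SmoothFormOn.differentiableAt (hW : IsOpen W) (hp : p ∈ W) (hθ : SmoothFormOn θ W) :
    DifferentiableAt ℝ (formInChart θ p) (extChartAt 𝓘(ℝ, Model n) p p) := by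
  suffices h : ∀ v, DifferentiableAt ℝ (fun y => formInChart θ p y v)
      (extChartAt 𝓘(ℝ, Model n) p p) by
    have h1 : formInChart θ p = fun y => ∑ i, formInChart θ p y (EuclideanSpace.single i 1) •
        (EuclideanSpace.proj i : Model n →L[ℝ] ℝ) := by
      funext y
      refine ContinuousLinearMap.ext fun v => ?_
      conv_lhs => rw [← (EuclideanSpace.basisFun (Fin (4 * n + 3)) ℝ).sum_repr v]
      simp [mul_comm]
    rw [h1]
    exact DifferentiableAt.fun_sum fun i _ => (h _).smul_const _
  intro v
  -- `V` is the field with constant components `v` in the chart, so `θ(V)` in the chart is the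
  -- component of `θ` to be differentiated, while smoothness of `V` is available on `M`.
  let V : ∀ q : M, T n q :=
    mpullback 𝓘(ℝ, Model n) 𝓘(ℝ, Model n) (extChartAt 𝓘(ℝ, Model n) p) (fun _ => v)
  have hV : ContMDiffAt 𝓘(ℝ, Model n) 𝓘(ℝ, Model n).tangent 1
      (fun p => (⟨p, V p⟩ : TangentBundle 𝓘(ℝ, Model n) M)) p := by
    refine ContMDiffAt.mpullback_vectorField_preimage (n := 2) ?_
      contMDiffAt_extChartAt (isInvertible_mfderiv_extChartAt (mem_extChartAt_source p))
      (by norm_num)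
    exact contMDiffAt_vectorSpace_iff_contDiffAt.2 contDiffAt_const
  have h1 := ContMDiffAt.clm_bundle_apply (b := fun q : M => q) (F₁ := Model n) (F₂ := ℝ)
    (E₁ := fun q : M => T n q) (E₂ := Bundle.Trivial M ℝ) (ϕ := θ) (v := V)
    ((hθ.contMDiffAt (hW.mem_nhds hp)).of_le (by simp)) hV
  rw [contMDiffAt_section] at h1
  replace h1 : ContMDiffAt 𝓘(ℝ, Model n) 𝓘(ℝ, ℝ) 1 (fun q => θ q (V q)) p := h1
  have h2 := (contMDiffAt_iff.1 h1).2
  rw [range_modelWithCorners, contDiffWithinAt_univ] at h2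
  refine (h2.differentiableAt one_ne_zero).congr_of_eventuallyEq ?_
  filter_upwards [eventually_mem_target p] with y hy
  have h3 : (chartD p ((extChartAt 𝓘(ℝ, Model n) p).symm y)).inverse = chartS p y :=
    ContinuousLinearMap.inverse_eq
      (ContinuousLinearMap.ext fun v => chartD_chartS hy v)
      (ContinuousLinearMap.ext fun v => chartS_chartD hy v)
  exact congrArg (fun L => θ ((extChartAt 𝓘(ℝ, Model n) p).symm y) (L v)) h3.symm

/-! ### Exterior and Lie derivatives of 1-forms -/

/-- The product rule for `v(θ(X))` in the chart at `p`. -/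
theorem dfun_form_apply (hW : IsOpen W) (hp : p ∈ W) (hθ : SmoothFormOn θ W)
    (hX : SmoothFieldOn X W) (v : T n p) :
    dfun (n := n) (fun q => θ q (X q)) p v =
      fderiv ℝ (formInChart θ p) (extChartAt 𝓘(ℝ, Model n) p p) (dchart p v) (dchart p (X p)) +
      formInChart θ p (extChartAt 𝓘(ℝ, Model n) p p)
        (fderiv ℝ (fieldInChart X p) (extChartAt 𝓘(ℝ, Model n) p p) (dchart p v)) := by
  have h : (fun q => θ q (X q)) ∘ (extChartAt 𝓘(ℝ, Model n) p).symm
      =ᶠ[𝓝 (extChartAt 𝓘(ℝ, Model n) p p)] fun y => formInChart θ p y (fieldInChart X p y) := by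
    filter_upwards [eventually_mem_target p] with y hy
    exact (formInChart_fieldInChart hy).symm
  rw [← fieldInChart_center, dfun_eq_fderiv ((hθ.apply hX).mdifferentiableAt hW hp), h.fderiv_eq,
    fderiv_clm_apply (hθ.differentiableAt hW hp) (hX.differentiableAt hW hp)]
  exact add_comm _ _

omit [IsManifold 𝓘(ℝ, Model n) ∞ M] in
theorem extD_eq (θ : ∀ p : M, T n p →L[ℝ] ℝ) (v w : T n p) :
    extD θ p v w =
      fderiv ℝ (formInChart θ p) (extChartAt 𝓘(ℝ, Model n) p p) (dchart p v) (dchart p w) -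
      fderiv ℝ (formInChart θ p) (extChartAt 𝓘(ℝ, Model n) p p) (dchart p w) (dchart p v) := rfl

/-- The invariant formula `dθ(X, Y) = X θ(Y) - Y θ(X) - θ([X, Y])`. -/
theorem extD_apply (hW : IsOpen W) (hp : p ∈ W) (hθ : SmoothFormOn θ W)
    (hX : SmoothFieldOn X W) (hY : SmoothFieldOn Y W) :
    extD θ p (X p) (Y p) = dfun (n := n) (fun q => θ q (Y q)) p (X p)
      - dfun (n := n) (fun q => θ q (X q)) p (Y p) - θ p (mlieBracket 𝓘(ℝ, Model n) X Y p) := by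
  rw [dfun_form_apply hW hp hθ hX, dfun_form_apply hW hp hθ hY,
    ← formInChart_center θ p (mlieBracket 𝓘(ℝ, Model n) X Y p), dchart_mlieBracket, lieBracket,
    fieldInChart_center, fieldInChart_center, map_sub]
  rw [extD_eq]
  ring

/-- Cartan's formula `L_X θ = d(θ(X)) + ι_X dθ`. -/
theorem lieD_apply (hW : IsOpen W) (hp : p ∈ W) (hθ : SmoothFormOn θ W)
    (hX : SmoothFieldOn X W) (v : T n p) :
    lieD X θ p v = dfun (n := n) (fun q => θ q (X q)) p v + extD θ p (X p) v := by
  rw [dfun_form_apply hW hp hθ hX, extD_eq]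
  have h : lieD X θ p v =
      fderiv ℝ (formInChart θ p) (extChartAt 𝓘(ℝ, Model n) p p)
        (fieldInChart X p (extChartAt 𝓘(ℝ, Model n) p p)) (dchart p v) +
      formInChart θ p (extChartAt 𝓘(ℝ, Model n) p p)
        (fderiv ℝ (fieldInChart X p) (extChartAt 𝓘(ℝ, Model n) p p) (dchart p v)) := rfl
  rw [h, fieldInChart_center]
  ring

omit [IsManifold 𝓘(ℝ, Model n) ∞ M] in
theorem extD_swap (θ : ∀ p : M, T n p →L[ℝ] ℝ) (v w : T n p) :
    extD θ p v w = - extD θ p w v := by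
  rw [extD_eq, extD_eq, neg_sub]

omit [IsManifold 𝓘(ℝ, Model n) ∞ M] in
theorem extD_self (θ : ∀ p : M, T n p →L[ℝ] ℝ) (v : T n p) : extD θ p v v = 0 := by
  have h := extD_swap θ v v
  linarith

theorem isManifold_minSmoothness (k : ℕ) :
    IsManifold 𝓘(ℝ, Model n) (minSmoothness ℝ k) M := by
  rw [minSmoothness_of_isRCLikeNormedField]
  exact IsManifold.of_le (n := ∞) ENat.LEInfty.out

theorem SmoothFieldOn.mlieBracket (hW : IsOpen W)
    (hX : SmoothFieldOn X W) (hY : SmoothFieldOn Y W) :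
    SmoothFieldOn (VectorField.mlieBracket 𝓘(ℝ, Model n) X Y) W := fun q hq =>
  haveI : IsManifold 𝓘(ℝ, Model n) (minSmoothness ℝ 2) M := isManifold_minSmoothness 2
  haveI : IsManifold 𝓘(ℝ, Model n) (minSmoothness ℝ 3) M := isManifold_minSmoothness 3
  haveI : IsManifold 𝓘(ℝ, Model n) ((⊤ : ℕ∞) + 1) M := ‹IsManifold 𝓘(ℝ, Model n) ∞ M›
  (ContMDiffAt.mlieBracket_vectorField (m := ⊤) (n := ⊤) (hX.contMDiffAt (hW.mem_nhds hq))
    (hY.contMDiffAt (hW.mem_nhds hq)) (by simp)).contMDiffWithinAt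

theorem SmoothFormOn.extD_apply (hW : IsOpen W) (hθ : SmoothFormOn θ W)
    (hX : SmoothFieldOn X W) (hY : SmoothFieldOn Y W) :
    SmoothFunOn (n := n) (fun q => extD θ q (X q) (Y q)) W :=
  (((hθ.apply hY).dfun_apply hW hX).sub ((hθ.apply hX).dfun_apply hW hY)
    |>.sub (hθ.apply (hX.mlieBracket hW hY))).congr fun _ hq => QC.extD_apply hW hq hθ hX hY

omit [IsManifold 𝓘(ℝ, Model n) ∞ M] in
theorem dfun_congr {f g : M → ℝ} (hW : IsOpen W) (hp : p ∈ W) (h : EqOn f g W) (v : T n p) :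
    dfun (n := n) f p v = dfun (n := n) g p v :=
  congrArg (fun L : T n p →L[ℝ] ℝ => L v)
    (Filter.EventuallyEq.mfderiv_eq (h.eventuallyEq_of_mem (hW.mem_nhds hp)))

omit [IsManifold 𝓘(ℝ, Model n) ∞ M] in
theorem dfun_sub {f g : M → ℝ} (hW : IsOpen W) (hp : p ∈ W) (hf : SmoothFunOn (n := n) f W)
    (hg : SmoothFunOn (n := n) g W) (v : T n p) :
    dfun (n := n) (fun q => f q - g q) p v = dfun (n := n) f p v - dfun (n := n) g p v :=
  congrArg (fun L : T n p →L[ℝ] ℝ => L v)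
    (mfderiv_sub (hf.mdifferentiableAt hW hp) (hg.mdifferentiableAt hW hp))

omit [IsManifold 𝓘(ℝ, Model n) ∞ M] in
theorem dfun_neg (f : M → ℝ) (v : T n p) :
    dfun (n := n) (fun q => -f q) p v = -dfun (n := n) f p v :=
  congrArg (fun L : T n p →L[ℝ] ℝ => L v) mfderiv_neg

/-- `d(dθ) = 0`, written with the invariant formula for the exterior derivative of a `2`-form. The
second derivatives of `θ` cancel by `dfun_mlieBracket`, the double brackets by the Jacobi
identity. -/
theorem extD_extD (hW : IsOpen W) (hp : p ∈ W) (hθ : SmoothFormOn θ W)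
    (hX : SmoothFieldOn X W) (hY : SmoothFieldOn Y W) (hZ : SmoothFieldOn Z W) :
    dfun (n := n) (fun q => extD θ q (Y q) (Z q)) p (X p)
      + dfun (n := n) (fun q => extD θ q (Z q) (X q)) p (Y p)
      + dfun (n := n) (fun q => extD θ q (X q) (Y q)) p (Z p)
      - extD θ p (mlieBracket 𝓘(ℝ, Model n) X Y p) (Z p)
      - extD θ p (mlieBracket 𝓘(ℝ, Model n) Y Z p) (X p)
      - extD θ p (mlieBracket 𝓘(ℝ, Model n) Z X p) (Y p) = 0 := by
  have key : ∀ {X Y Z : ∀ p : M, T n p}, SmoothFieldOn X W → SmoothFieldOn Y W →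
      SmoothFieldOn Z W →
      dfun (n := n) (fun q => extD θ q (Y q) (Z q)) p (X p) =
        dfun (n := n) (fun q => dfun (n := n) (fun q => θ q (Z q)) q (Y q)) p (X p)
        - dfun (n := n) (fun q => dfun (n := n) (fun q => θ q (Y q)) q (Z q)) p (X p)
        - dfun (n := n) (fun q => θ q (mlieBracket 𝓘(ℝ, Model n) Y Z q)) p (X p) := by
    intro X Y Z hX hY hZ
    rw [dfun_congr hW hp (fun q hq => QC.extD_apply hW hq hθ hY hZ),
      dfun_sub hW hp (((hθ.apply hZ).dfun_apply hW hY).sub ((hθ.apply hY).dfun_apply hW hZ))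
        (hθ.apply (hY.mlieBracket hW hZ)),
      dfun_sub hW hp ((hθ.apply hZ).dfun_apply hW hY) ((hθ.apply hY).dfun_apply hW hZ)]
  have h3 : IsManifold 𝓘(ℝ, Model n) (minSmoothness ℝ 3) M := isManifold_minSmoothness 3
  have h2 : minSmoothness ℝ 2 ≤ (∞ : WithTop ℕ∞) := by
    rw [minSmoothness_of_isRCLikeNormedField]
    exact ENat.LEInfty.out
  have hJ := leibniz_identity_mlieBracket_apply (I := 𝓘(ℝ, Model n)) (U := X) (V := Y) (W := Z)
    (x := p) ((hX.contMDiffAt (hW.mem_nhds hp)).of_le h2)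
    ((hY.contMDiffAt (hW.mem_nhds hp)).of_le h2) ((hZ.contMDiffAt (hW.mem_nhds hp)).of_le h2)
  rw [key hX hY hZ, key hY hZ hX, key hZ hX hY,
    QC.extD_apply hW hp hθ (hX.mlieBracket hW hY) hZ,
    QC.extD_apply hW hp hθ (hY.mlieBracket hW hZ) hX,
    QC.extD_apply hW hp hθ (hZ.mlieBracket hW hX) hY,
    dfun_mlieBracket hW hp (hθ.apply hZ) hX hY, dfun_mlieBracket hW hp (hθ.apply hX) hY hZ,
    dfun_mlieBracket hW hp (hθ.apply hY) hZ hX]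
  have hJ' : θ p (mlieBracket 𝓘(ℝ, Model n) (mlieBracket 𝓘(ℝ, Model n) X Y) Z p)
      + θ p (mlieBracket 𝓘(ℝ, Model n) (mlieBracket 𝓘(ℝ, Model n) Y Z) X p)
      + θ p (mlieBracket 𝓘(ℝ, Model n) (mlieBracket 𝓘(ℝ, Model n) Z X) Y p) = 0 := by
    have hZX : mlieBracket 𝓘(ℝ, Model n) Z X = (-1 : ℝ) • mlieBracket 𝓘(ℝ, Model n) X Z := by
      rw [mlieBracket_swap, neg_one_smul]
    rw [hZX, mlieBracket_const_smul_left
        (((hX.mlieBracket hW hZ).contMDiffAt (hW.mem_nhds hp)).mdifferentiableAt (by simp)),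
      mlieBracket_swap_apply (V := mlieBracket 𝓘(ℝ, Model n) Y Z) (W := X), hJ,
      mlieBracket_swap_apply (V := Y) (W := mlieBracket 𝓘(ℝ, Model n) X Z)]
    simp only [map_neg, map_add, map_smul, smul_eq_mul]
    ring
  linear_combination hJ'

end

instance (p : M) : FiniteDimensional ℝ (T n p) :=
  inferInstanceAs (FiniteDimensional ℝ (Model n))

omit [IsManifold 𝓘(ℝ, Model n) ∞ M] in
theorem finrank_tangent (p : M) : Module.finrank ℝ (T n p) = 4 * n + 3 :=
  (finrank_euclideanSpace_fin : Module.finrank ℝ (Model n) = 4 * n + 3)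

section
variable {W : Set M} {p : M} {ι : Type*} [Fintype ι] [DecidableEq ι]

omit [IsManifold 𝓘(ℝ, Model n) ∞ M] in
theorem SmoothFunOn.matrix_det {A : M → Matrix ι ι ℝ}
    (hA : ∀ i j, SmoothFunOn (n := n) (fun q => A q i j) W) :
    SmoothFunOn (n := n) (fun q => (A q).det) W := by
  simp only [Matrix.det_apply']
  refine contMDiffOn_finsetSum fun σ _ => ?_
  exact contMDiffOn_const.mul (contMDiffOn_finsetProd fun i _ => hA _ _)

omit [IsManifold 𝓘(ℝ, Model n) ∞ M] in
theorem SmoothFunOn.matrix_inv {A : M → Matrix ι ι ℝ}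
    (hA : ∀ i j, SmoothFunOn (n := n) (fun q => A q i j) W) (hdet : ∀ q ∈ W, (A q).det ≠ 0)
    (i j : ι) : SmoothFunOn (n := n) (fun q => (A q)⁻¹ i j) W := by
  simp only [Matrix.inv_def, Matrix.smul_apply, Ring.inverse_eq_inv', Matrix.adjugate_apply,
    smul_eq_mul]
  refine ((SmoothFunOn.matrix_det hA).inv₀ hdet).mul (SmoothFunOn.matrix_det fun k l => ?_)
  by_cases hk : k = j
  · subst hk
    simp only [Matrix.updateRow_self]
    exact contMDiffOn_const
  · simpa only [Matrix.updateRow_ne hk] using hA k l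

theorem exists_smoothFieldOn_extend (v : T n p) :
    ∃ (W : Set M) (X : ∀ q : M, T n q), IsOpen W ∧ p ∈ W ∧ SmoothFieldOn X W ∧ X p = v := by
  obtain ⟨s, hs, h⟩ := FiberBundle.exists_contMDiffOn_extend (I := 𝓘(ℝ, Model n)) (k := ∞)
    (Model n) (V := fun q : M => T n q) v
  exact ⟨interior s, _, isOpen_interior, mem_interior_iff_mem_nhds.2 hs, h.mono interior_subset,
    FiberBundle.extend_apply_self (Model n) v⟩

end

theorem sum_fin_three_cyclic {A : Type*} [AddCommMonoid A] (f : Fin 3 → A) (i : Fin 3) :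
    ∑ s, f s = f i + f (i + 1) + f (i + 2) := by
  rw [Fin.sum_univ_three]
  fin_cases i
  · rfl
  · change f 0 + f 1 + f 2 = f 1 + f 2 + f 0
    abel
  · change f 0 + f 1 + f 2 = f 2 + f 0 + f 1
    abel

/-! ### Smooth frames dual to a contact form -/

variable {S : Data n M} (F : S.ContactForm) {p : M}

namespace Data.ContactForm

/-- The forms `η₁, η₂, η₃` are linearly independent at every point, as `H` has codimension three. -/
theorem exists_dual (hp : p ∈ F.U) (c : Fin 3 → ℝ) : ∃ v : T n p, ∀ s, F.η s p v = c s := by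
  let L : T n p →ₗ[ℝ] (Fin 3 → ℝ) := LinearMap.pi fun s => (F.η s p : T n p →ₗ[ℝ] ℝ)
  have hker : LinearMap.ker L = S.H p := by
    ext v
    rw [LinearMap.mem_ker, F.mem_H p hp]
    exact funext_iff
  have h := L.finrank_range_add_finrank_ker
  rw [hker, S.finrank_H, finrank_tangent] at h
  have hr : LinearMap.range L = ⊤ := Submodule.eq_top_of_finrank_eq (by simp; omega)
  obtain ⟨v, hv⟩ := LinearMap.range_eq_top.1 hr c
  exact ⟨v, fun s => congrFun hv s⟩

/-- Around every point there are smooth vector fields dual to `η`. -/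
theorem exists_dualFrame (hp : p ∈ F.U) :
    ∃ (W : Set M) (e : Fin 3 → ∀ q : M, T n q), IsOpen W ∧ p ∈ W ∧ W ⊆ F.U ∧
      (∀ k, SmoothFieldOn (e k) W) ∧
      ∀ q ∈ W, ∀ s k, F.η s q (e k q) = if s = k then 1 else 0 := by
  choose v hv using fun k : Fin 3 => F.exists_dual hp (fun s => if s = k then 1 else 0)
  choose V Y hV hpV hY hYp using fun k => exists_smoothFieldOn_extend (v k)
  let W₀ : Set M := F.U ∩ ⋂ k, V k
  have hW₀ : IsOpen W₀ := F.isOpen_U.inter (isOpen_iInter_of_finite hV)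
  have hpW₀ : p ∈ W₀ := ⟨hp, mem_iInter.2 hpV⟩
  have hY₀ : ∀ k, SmoothFieldOn (Y k) W₀ := fun k =>
    (hY k).mono (inter_subset_right.trans (iInter_subset _ k))
  -- Smooth fields `Y_k` that are dual to `η` at `p` are corrected by the inverse of the matrix
  -- `η_s(Y_k)`, on the open set where it is invertible.
  let A : M → Matrix (Fin 3) (Fin 3) ℝ := fun q => Matrix.of fun s k => F.η s q (Y k q)
  have hA : ∀ s k, SmoothFunOn (n := n) (fun q => A q s k) W₀ := fun s k =>
    SmoothFormOn.apply ((F.η_smooth s).mono inter_subset_left) (hY₀ k)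
  let W : Set M := W₀ ∩ (fun q => (A q).det) ⁻¹' {0}ᶜ
  have hW : IsOpen W := (SmoothFunOn.matrix_det hA).continuousOn.isOpen_inter_preimage hW₀
    isOpen_compl_singleton
  have hAp : A p = 1 := by
    ext s k
    simp [A, hYp, hv, Matrix.one_apply]
  have hWW : W ⊆ W₀ := inter_subset_left
  refine ⟨W, fun k q => ∑ l, (A q)⁻¹ l k • Y l q, hW, ⟨hpW₀, by simp [hAp]⟩,
    hWW.trans inter_subset_left, fun k => ?_, fun q hq s k => ?_⟩
  · have h : ∀ l, SmoothFieldOn (fun q => (A q)⁻¹ l k • Y l q) W := fun l =>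
      ContMDiffOn.smul_section
        (SmoothFunOn.matrix_inv (fun i j => (hA i j).mono hWW) (fun q hq => hq.2) l k)
        ((hY₀ l).mono hWW)
    exact ContMDiffOn.sum_section fun l _ => h l
  · have h1 : A q * (A q)⁻¹ = 1 := Matrix.mul_nonsing_inv _ (isUnit_iff_ne_zero.2 hq.2)
    have h2 := congrFun (congrFun h1 s) k
    rw [Matrix.mul_apply, Matrix.one_apply] at h2
    rw [← h2, map_sum]
    refine Finset.sum_congr rfl fun l _ => ?_
    rw [map_smul, smul_eq_mul, mul_comm]
    rfl

/-- Every horizontal vector extends to a smooth horizontal field: take any extension and subtract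
its components along a smooth frame dual to `η`. -/
theorem exists_horizontal_extend (hp : p ∈ F.U) (v : S.H p) :
    ∃ (W : Set M) (X : ∀ q : M, S.H q), IsOpen W ∧ p ∈ W ∧ W ⊆ F.U ∧
      SmoothFieldOn (fun q => (X q : T n q)) W ∧ X p = v := by
  classical
  obtain ⟨W, e, hW, hpW, hWU, he, hηe⟩ := F.exists_dualFrame hp
  obtain ⟨V, Y, hV, hpV, hY, hYp⟩ := exists_smoothFieldOn_extend (v : T n p)
  have hmem : ∀ q ∈ W, Y q - ∑ s, F.η s q (Y q) • e s q ∈ S.H q := by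
    intro q hq
    rw [F.mem_H q (hWU hq)]
    intro s
    simp [hηe q hq]
  let X : ∀ q : M, S.H q := fun q =>
    if hq : q ∈ W then ⟨Y q - ∑ s, F.η s q (Y q) • e s q, hmem q hq⟩ else 0
  have hX : ∀ q ∈ W, (X q : T n q) = Y q - ∑ s, F.η s q (Y q) • e s q := by
    intro q hq
    simp [X, hq]
  refine ⟨W ∩ V, X, hW.inter hV, ⟨hpW, hpV⟩, inter_subset_left.trans hWU, ?_, ?_⟩
  · have h : ∀ s, SmoothFieldOn (fun q => F.η s q (Y q) • e s q) (W ∩ V) := fun s =>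
      ContMDiffOn.smul_section (SmoothFormOn.apply
        ((F.η_smooth s).mono (inter_subset_left.trans hWU)) (hY.mono inter_subset_right))
        ((he s).mono inter_subset_left)
    have h2 := ContMDiffOn.sub_section (hY.mono inter_subset_right)
      (ContMDiffOn.sum_section (s := Finset.univ) fun s _ => h s)
    refine h2.congr fun q hq => ?_
    exact congrArg (Bundle.TotalSpace.mk q) (hX q hq.1)
  · refine Subtype.ext ?_
    have h0 := (F.mem_H p hp v).1 v.2
    rw [hX p hpW, hYp]
    simp [h0]

/-! ### Quaternionic algebra on the horizontal distribution -/

section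
variable (hp : p ∈ F.U)
include hp

theorem I_I (s : Fin 3) (X : S.H p) : F.I s p (F.I s p X) = -X :=
  LinearMap.congr_fun (F.I_sq s p hp) X

theorem I_zero_I_one (X : S.H p) : F.I 0 p (F.I 1 p X) = F.I 2 p X :=
  LinearMap.congr_fun (F.I_mul p hp) X

theorem I_one_I_zero (X : S.H p) : F.I 1 p (F.I 0 p X) = -F.I 2 p X :=
  LinearMap.congr_fun (F.I_mul' p hp) X

theorem I_I_succ (i : Fin 3) (X : S.H p) : F.I i p (F.I (i + 1) p X) = F.I (i + 2) p X := by
  have h01 := F.I_zero_I_one hp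
  have h10 := F.I_one_I_zero hp
  have h := F.I_I hp
  fin_cases i
  · exact h01 X
  · change F.I 1 p (F.I 2 p X) = F.I 0 p X
    rw [← h01 X, h10, ← h01, h, map_neg, neg_neg]
  · change F.I 2 p (F.I 0 p X) = F.I 1 p X
    rw [← neg_inj, ← h10, h, map_neg]

theorem I_succ_I (i : Fin 3) (X : S.H p) : F.I (i + 1) p (F.I i p X) = -F.I (i + 2) p X := by
  have h01 := F.I_zero_I_one hp
  have h := F.I_I hp
  fin_cases i
  · exact F.I_one_I_zero hp X
  · change F.I 2 p (F.I 1 p X) = -F.I 0 p X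
    rw [← h01, h, map_neg]
  · change F.I 0 p (F.I 2 p X) = -F.I 1 p X
    rw [← h01, h]

theorem I_add_two_I (i : Fin 3) (X : S.H p) : F.I (i + 2) p (F.I i p X) = F.I (i + 1) p X := by
  have h := F.I_I_succ hp (i + 2) X
  rwa [show i + 2 + 1 = i by fin_cases i <;> rfl,
    show i + 2 + 2 = i + 1 by fin_cases i <;> rfl] at h

/-- The `2`-form `dη_s` on `H` is `2 g(I_s ·, ·)`. -/
theorem extD_eq_two_mul_g (s : Fin 3) (X Y : S.H p) :
    extD (F.η s) p (X : T n p) (Y : T n p) = 2 * S.g p (F.I s p X) Y :=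
  (F.compat s p hp X Y).symm

theorem g_I_skew (s : Fin 3) (X Y : S.H p) : S.g p (F.I s p X) Y = -S.g p X (F.I s p Y) := by
  have h := extD_swap (F.η s) (X : T n p) (Y : T n p)
  rw [F.extD_eq_two_mul_g hp, F.extD_eq_two_mul_g hp, S.g_symm p (F.I s p Y)] at h
  linarith

theorem extD_I_left (i : Fin 3) (X Y : S.H p) :
    extD (F.η i) p (F.I i p X : T n p) (Y : T n p) = -(2 * S.g p X Y) := by
  rw [F.extD_eq_two_mul_g hp, F.I_I hp]
  simp

theorem extD_I_right (i : Fin 3) (X Y : S.H p) :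
    extD (F.η i) p (X : T n p) (F.I i p Y : T n p) = 2 * S.g p X Y := by
  rw [extD_swap, F.extD_I_left hp, neg_neg, S.g_symm]

theorem extD_succ_I_left (i : Fin 3) (X Y : S.H p) :
    extD (F.η (i + 1)) p (F.I i p X : T n p) (Y : T n p) =
      -extD (F.η (i + 2)) p (X : T n p) (Y : T n p) := by
  rw [F.extD_eq_two_mul_g hp, F.extD_eq_two_mul_g hp, F.I_succ_I hp]
  simp

theorem extD_succ_I_right (i : Fin 3) (X Y : S.H p) :
    extD (F.η (i + 1)) p (X : T n p) (F.I i p Y : T n p) =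
      -extD (F.η (i + 2)) p (X : T n p) (Y : T n p) := by
  rw [extD_swap, F.extD_succ_I_left hp, neg_neg, extD_swap]

theorem extD_add_two_I_left (i : Fin 3) (X Y : S.H p) :
    extD (F.η (i + 2)) p (F.I i p X : T n p) (Y : T n p) =
      extD (F.η (i + 1)) p (X : T n p) (Y : T n p) := by
  rw [F.extD_eq_two_mul_g hp, F.extD_eq_two_mul_g hp, F.I_add_two_I hp]

theorem extD_add_two_I_right (i : Fin 3) (X Y : S.H p) :
    extD (F.η (i + 2)) p (X : T n p) (F.I i p Y : T n p) =
      extD (F.η (i + 1)) p (X : T n p) (Y : T n p) := by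
  rw [extD_swap, F.extD_add_two_I_left hp, ← extD_swap]

end

/-- The Lie bracket of two horizontal fields, which is a tangent vector that need not be
horizontal. -/
abbrev horizontalBracket (X Y : ∀ q : M, S.H q) (p : M) : T n p :=
  mlieBracket 𝓘(ℝ, Model n) (fun q => (X q : T n q)) (fun q => (Y q : T n q)) p

/-- For horizontal fields, `η_s([X, Y]) = -dη_s(X, Y)`. -/
theorem η_mlieBracket {W : Set M} (hW : IsOpen W) (hp : p ∈ W) (hWU : W ⊆ F.U)
    {X Y : ∀ q : M, S.H q} (hX : SmoothFieldOn (fun q => (X q : T n q)) W)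
    (hY : SmoothFieldOn (fun q => (Y q : T n q)) W) (s : Fin 3) :
    F.η s p (horizontalBracket X Y p) =
      -extD (F.η s) p (X p : T n p) (Y p : T n p) := by
  have h0 : ∀ (Z : ∀ q : M, S.H q) (v : T n p),
      dfun (n := n) (fun q => F.η s q (Z q : T n q)) p v = 0 := by
    intro Z v
    rw [dfun_congr (g := fun _ => (0 : ℝ)) hW hp
      (fun q hq => (F.mem_H q (hWU hq) _).1 (Z q).2 s)]
    exact congrArg (fun L : T n p →L[ℝ] ℝ => L v) mfderiv_const
  have h := QC.extD_apply (X := fun q => (X q : T n q)) (Y := fun q => (Y q : T n q)) hW hp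
    ((F.η_smooth s).mono hWU) hX hY
  rw [h0, h0] at h
  linarith

/-! ### Existence of the Reeb vector fields -/

/-- The decomposition `T_p M = H ⊕ span {ξ₁, ξ₂, ξ₃}` for any frame `ξ` dual to `η`. -/
theorem exists_eq_add_sum (hp : p ∈ F.U) {ξ : Fin 3 → T n p}
    (hξ : ∀ s k, F.η s p (ξ k) = if s = k then 1 else 0) (w : T n p) :
    ∃ h : S.H p, w = h + ∑ s, F.η s p w • ξ s := by
  refine ⟨⟨w - ∑ s, F.η s p w • ξ s, ?_⟩, by simp⟩
  rw [F.mem_H p hp]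
  intro s
  simp [hξ]

section
variable (hp : p ∈ F.U) {ξ : Fin 3 → T n p}
  (hξ : ∀ s k, F.η s p (ξ k) = if s = k then 1 else 0)
include hp hξ

/-- The real part of `ω(w, Z + √-1 I_i Z)`, where `ω = dη_{i+1} + √-1 dη_{i+2}`. The horizontal part
of `w` does not contribute, because `ω` has type `(2, 0)` on `H` with respect to `I_i`. -/
theorem extD_sub_extD_I (i : Fin 3) (w : T n p) (Z : S.H p) :
    extD (F.η (i + 1)) p w (Z : T n p) - extD (F.η (i + 2)) p w (F.I i p Z : T n p) =
      ∑ s, F.η s p w * (extD (F.η (i + 1)) p (ξ s) (Z : T n p)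
        - extD (F.η (i + 2)) p (ξ s) (F.I i p Z : T n p)) := by
  obtain ⟨h, hw⟩ := F.exists_eq_add_sum hp hξ w
  conv_lhs => rw [hw]
  simp only [map_add, map_sum, map_smul, LinearMap.add_apply, LinearMap.sum_apply,
    LinearMap.smul_apply, smul_eq_mul, mul_sub, Finset.sum_sub_distrib,
    F.extD_add_two_I_right hp]
  ring

/-- The imaginary part of `ω(w, Z + √-1 I_i Z)`; compare `extD_sub_extD_I`. -/
theorem extD_I_add_extD (i : Fin 3) (w : T n p) (Z : S.H p) :
    extD (F.η (i + 1)) p w (F.I i p Z : T n p) + extD (F.η (i + 2)) p w (Z : T n p) =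
      ∑ s, F.η s p w * (extD (F.η (i + 1)) p (ξ s) (F.I i p Z : T n p)
        + extD (F.η (i + 2)) p (ξ s) (Z : T n p)) := by
  obtain ⟨h, hw⟩ := F.exists_eq_add_sum hp hξ w
  conv_lhs => rw [hw]
  simp only [map_add, map_sum, map_smul, LinearMap.add_apply, LinearMap.sum_apply,
    LinearMap.smul_apply, smul_eq_mul, mul_add, Finset.sum_add_distrib,
    F.extD_succ_I_right hp]
  ring

end

/-- For a frame `ξ` dual to `η`, the `1`-form `γ_i(X) = dη_{i+2}(ξ_{i+1}, X) + dη_{i+1}(ξ_{i+2}, X)`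
on `H`. If moreover `dη_s(ξ_s, ·)` vanishes on `H` for all `s`, then `ξ` satisfies the Reeb
conditions at `p` if and only if all `γ_i` vanish. -/
def skewDefect (ξ : Fin 3 → T n p) (i : Fin 3) (X : S.H p) : ℝ :=
  extD (F.η (i + 2)) p (ξ (i + 1)) (X : T n p) + extD (F.η (i + 1)) p (ξ (i + 2)) (X : T n p)

section
variable {W : Set M} (hW : IsOpen W) (hp : p ∈ W) (hWU : W ⊆ F.U) {ξ : Fin 3 → T n p}
  (hξ : ∀ s k, F.η s p (ξ k) = if s = k then 1 else 0)
  (hd : ∀ s, ∀ X : S.H p, extD (F.η s) p (ξ s) (X : T n p) = 0)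
  {X Y Z : ∀ q : M, S.H q} (hX : SmoothFieldOn (fun q => (X q : T n q)) W)
  (hY : SmoothFieldOn (fun q => (Y q : T n q)) W) (hZ : SmoothFieldOn (fun q => (Z q : T n q)) W)
include hW hp hWU

include hξ hd hX hY in
/-- The real part of `ω([X + √-1 I_i X, Y + √-1 I_i Y], Z + √-1 I_i Z)`, where
`ω = dη_{i+1} + √-1 dη_{i+2}`. Only the vertical part of the bracket matters, and
`η_s([X, Y]) = -dη_s(X, Y)` for horizontal fields. -/
theorem extD_mlieBracket_combination (i : Fin 3) (Z : S.H p) :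
    (extD (F.η (i + 1)) p (horizontalBracket X Y p) (Z : T n p)
      - extD (F.η (i + 2)) p (horizontalBracket X Y p) (F.I i p Z : T n p))
    - (extD (F.η (i + 1)) p (horizontalBracket (fun q => F.I i q (X q))
          (fun q => F.I i q (Y q)) p) (Z : T n p)
      - extD (F.η (i + 2)) p (horizontalBracket (fun q => F.I i q (X q))
          (fun q => F.I i q (Y q)) p) (F.I i p Z : T n p))
    - (extD (F.η (i + 1)) p (horizontalBracket (fun q => F.I i q (X q)) Y p) (F.I i p Z : T n p)
      + extD (F.η (i + 2)) p (horizontalBracket (fun q => F.I i q (X q)) Y p) (Z : T n p))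
    - (extD (F.η (i + 1)) p (horizontalBracket X (fun q => F.I i q (Y q)) p) (F.I i p Z : T n p)
      + extD (F.η (i + 2)) p (horizontalBracket X (fun q => F.I i q (Y q)) p) (Z : T n p))
    = 2 * (extD (F.η (i + 1)) p (X p : T n p) (Y p : T n p) * F.skewDefect ξ i (F.I i p Z)
      - extD (F.η (i + 2)) p (X p : T n p) (Y p : T n p) * F.skewDefect ξ i Z) := by
  have hpU := hWU hp
  have hJ : ∀ {X : ∀ q : M, S.H q}, SmoothFieldOn (fun q => (X q : T n q)) W →
      SmoothFieldOn (fun q => (F.I i q (X q) : T n q)) W := fun h => F.I_smooth i W hWU hW _ h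
  have e1 := F.η_mlieBracket hW hp hWU hX hY
  have e2 := F.η_mlieBracket hW hp hWU (X := fun q => F.I i q (X q)) (Y := fun q => F.I i q (Y q))
    (hJ hX) (hJ hY)
  have e3 := F.η_mlieBracket hW hp hWU (X := fun q => F.I i q (X q)) (hJ hX) hY
  have e4 := F.η_mlieBracket hW hp hWU (Y := fun q => F.I i q (Y q)) hX (hJ hY)
  have P := fun w => F.extD_sub_extD_I hpU hξ i w Z
  have R := fun w => F.extD_I_add_extD hpU hξ i w Z
  simp only [sum_fin_three_cyclic _ i] at P R
  rw [P, P (horizontalBracket (fun q => F.I i q (X q)) _ p),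
    R (horizontalBracket (fun q => F.I i q (X q)) _ p), R (horizontalBracket X _ p)]
  -- `dη_i` has type `(1, 1)` for `I_i`, so the `ξ_i`-component of the bracket drops out.
  have e0 : extD (F.η i) p (F.I i p (X p) : T n p) (F.I i p (Y p) : T n p) =
      extD (F.η i) p (X p : T n p) (Y p : T n p) := by
    rw [F.extD_I_right hpU, F.extD_eq_two_mul_g hpU]
  simp only [e1, e2, e3, e4, e0, F.extD_I_left hpU, F.extD_I_right hpU, F.extD_succ_I_left hpU,
    F.extD_succ_I_right hpU, F.extD_add_two_I_left hpU, F.extD_add_two_I_right hpU, hd, skewDefect]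
  ring

include hX hY hZ in
/-- `d(dη_s) = 0` on horizontal fields. -/
theorem cyclic_sum_extD_field (s : Fin 3) :
    dfun (n := n) (fun q => extD (F.η s) q (Y q : T n q) (Z q : T n q)) p (X p : T n p)
      + dfun (n := n) (fun q => extD (F.η s) q (Z q : T n q) (X q : T n q)) p (Y p : T n p)
      + dfun (n := n) (fun q => extD (F.η s) q (X q : T n q) (Y q : T n q)) p (Z p : T n p)
      - extD (F.η s) p (horizontalBracket X Y p) (Z p : T n p)
      - extD (F.η s) p (horizontalBracket Y Z p) (X p : T n p)
      - extD (F.η s) p (horizontalBracket Z X p) (Y p : T n p) = 0 :=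
  QC.extD_extD hW hp ((F.η_smooth s).mono hWU) hX hY hZ

include hξ hd hX hY hZ in
/-- The real part of `dω = 0` on `X + √-1 I_i X`, `Y + √-1 I_i Y`, `Z + √-1 I_i Z`, where
`ω = dη_{i+1} + √-1 dη_{i+2}`. -/
theorem cyclic_identity_field (i : Fin 3) :
    (extD (F.η (i + 1)) p (X p : T n p) (Y p : T n p) * F.skewDefect ξ i (F.I i p (Z p))
      - extD (F.η (i + 2)) p (X p : T n p) (Y p : T n p) * F.skewDefect ξ i (Z p))
    + (extD (F.η (i + 1)) p (Y p : T n p) (Z p : T n p) * F.skewDefect ξ i (F.I i p (X p))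
      - extD (F.η (i + 2)) p (Y p : T n p) (Z p : T n p) * F.skewDefect ξ i (X p))
    + (extD (F.η (i + 1)) p (Z p : T n p) (X p : T n p) * F.skewDefect ξ i (F.I i p (Y p))
      - extD (F.η (i + 2)) p (Z p : T n p) (X p : T n p) * F.skewDefect ξ i (Y p)) = 0 := by
  have hpU := hWU hp
  have hJ : ∀ {X : ∀ q : M, S.H q}, SmoothFieldOn (fun q => (X q : T n q)) W →
      SmoothFieldOn (fun q => (F.I i q (X q) : T n q)) W := fun h => F.I_smooth i W hWU hW _ h
  -- By `r1`, `r2`, `r3`, `r4`, which say that `ω` has type `(2, 0)`, all terms in which a function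
  -- `ω(·, ·)` is differentiated cancel.
  have r1 : ∀ (Y Z : ∀ q : M, S.H q) (v : T n p),
      dfun (n := n) (fun q => extD (F.η (i + 1)) q (F.I i q (Y q) : T n q) (Z q : T n q)) p v =
      -dfun (n := n) (fun q => extD (F.η (i + 2)) q (Y q : T n q) (Z q : T n q)) p v := by
    intro Y Z v
    rw [← dfun_neg]
    exact dfun_congr hW hp (fun q hq => F.extD_succ_I_left (hWU hq) i _ _) v
  have r2 : ∀ (Y Z : ∀ q : M, S.H q) (v : T n p),
      dfun (n := n) (fun q => extD (F.η (i + 1)) q (Y q : T n q) (F.I i q (Z q) : T n q)) p v =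
      -dfun (n := n) (fun q => extD (F.η (i + 2)) q (Y q : T n q) (Z q : T n q)) p v := by
    intro Y Z v
    rw [← dfun_neg]
    exact dfun_congr hW hp (fun q hq => F.extD_succ_I_right (hWU hq) i _ _) v
  have r3 : ∀ (Y Z : ∀ q : M, S.H q) (v : T n p),
      dfun (n := n) (fun q => extD (F.η (i + 2)) q (F.I i q (Y q) : T n q) (Z q : T n q)) p v =
      dfun (n := n) (fun q => extD (F.η (i + 1)) q (Y q : T n q) (Z q : T n q)) p v :=
    fun Y Z v => dfun_congr hW hp (fun q hq => F.extD_add_two_I_left (hWU hq) i _ _) v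
  have r4 : ∀ (Y Z : ∀ q : M, S.H q) (v : T n p),
      dfun (n := n) (fun q => extD (F.η (i + 2)) q (Y q : T n q) (F.I i q (Z q) : T n q)) p v =
      dfun (n := n) (fun q => extD (F.η (i + 1)) q (Y q : T n q) (Z q : T n q)) p v :=
    fun Y Z v => dfun_congr hW hp (fun q hq => F.extD_add_two_I_right (hWU hq) i _ _) v
  let J : (∀ q : M, S.H q) → ∀ q : M, S.H q := fun X q => F.I i q (X q)
  -- The real part of `dω` on the three complex fields consists of the terms of `d(dη_{i+1})` with
  -- an even number of factors `√-1` and those of `d(dη_{i+2})` with an odd number.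
  have t1 := F.cyclic_sum_extD_field hW hp hWU hX hY hZ (i + 1)
  have t2 := F.cyclic_sum_extD_field hW hp hWU (X := J X) (Y := J Y) (hJ hX) (hJ hY) hZ (i + 1)
  have t3 := F.cyclic_sum_extD_field hW hp hWU (X := J X) (Z := J Z) (hJ hX) hY (hJ hZ) (i + 1)
  have t4 := F.cyclic_sum_extD_field hW hp hWU (Y := J Y) (Z := J Z) hX (hJ hY) (hJ hZ) (i + 1)
  have t5 := F.cyclic_sum_extD_field hW hp hWU (X := J X) (hJ hX) hY hZ (i + 2)
  have t6 := F.cyclic_sum_extD_field hW hp hWU (Y := J Y) hX (hJ hY) hZ (i + 2)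
  have t7 := F.cyclic_sum_extD_field hW hp hWU (Z := J Z) hX hY (hJ hZ) (i + 2)
  have t8 := F.cyclic_sum_extD_field hW hp hWU (X := J X) (Y := J Y) (Z := J Z)
    (hJ hX) (hJ hY) (hJ hZ) (i + 2)
  simp only [J, r1, r2, r3, r4] at t1 t2 t3 t4 t5 t6 t7 t8
  have b1 := F.extD_mlieBracket_combination hW hp hWU hξ hd hX hY i (Z p)
  have b2 := F.extD_mlieBracket_combination hW hp hWU hξ hd hY hZ i (X p)
  have b3 := F.extD_mlieBracket_combination hW hp hWU hξ hd hZ hX i (Y p)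
  linear_combination (1 / 2) * (-t1 + t2 + t3 + t4 + t5 + t6 + t7 - t8 - b1 - b2 - b3)

end

/-- The identity `cyclic_identity_field` is tensorial, so it holds for horizontal vectors. -/
theorem cyclic_identity (hp : p ∈ F.U) {ξ : Fin 3 → T n p}
    (hξ : ∀ s k, F.η s p (ξ k) = if s = k then 1 else 0)
    (hd : ∀ s, ∀ X : S.H p, extD (F.η s) p (ξ s) (X : T n p) = 0) (i : Fin 3) (X Y Z : S.H p) :
    (extD (F.η (i + 1)) p (X : T n p) (Y : T n p) * F.skewDefect ξ i (F.I i p Z)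
      - extD (F.η (i + 2)) p (X : T n p) (Y : T n p) * F.skewDefect ξ i Z)
    + (extD (F.η (i + 1)) p (Y : T n p) (Z : T n p) * F.skewDefect ξ i (F.I i p X)
      - extD (F.η (i + 2)) p (Y : T n p) (Z : T n p) * F.skewDefect ξ i X)
    + (extD (F.η (i + 1)) p (Z : T n p) (X : T n p) * F.skewDefect ξ i (F.I i p Y)
      - extD (F.η (i + 2)) p (Z : T n p) (X : T n p) * F.skewDefect ξ i Y) = 0 := by
  obtain ⟨W₁, X', hW₁, hp₁, hU, hX, rfl⟩ := F.exists_horizontal_extend hp X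
  obtain ⟨W₂, Y', hW₂, hp₂, -, hY, rfl⟩ := F.exists_horizontal_extend hp Y
  obtain ⟨W₃, Z', hW₃, hp₃, -, hZ, rfl⟩ := F.exists_horizontal_extend hp Z
  exact F.cyclic_identity_field (W := W₁ ∩ (W₂ ∩ W₃)) (hW₁.inter (hW₂.inter hW₃))
    ⟨hp₁, hp₂, hp₃⟩ (inter_subset_left.trans hU) hξ hd (hX.mono inter_subset_left)
    (hY.mono (inter_subset_right.trans inter_subset_left))
    (hZ.mono (inter_subset_right.trans inter_subset_right)) i

/-- The four linear conditions have a nonzero solution, since `dim H = 4n > 4`. -/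
theorem exists_orthogonal (hn : 2 ≤ n) (Z : S.H p) :
    ∃ X : S.H p, X ≠ 0 ∧ S.g p X Z = 0 ∧ ∀ s, S.g p X (F.I s p Z) = 0 := by
  let L : S.H p →ₗ[ℝ] (Option (Fin 3) → ℝ) := LinearMap.pi fun o =>
    (S.g p).flip (o.elim Z fun s => F.I s p Z)
  have hker : LinearMap.ker L ≠ ⊥ := LinearMap.ker_ne_bot_of_finrank_lt (by
    rw [S.finrank_H, Module.finrank_pi]
    simp
    omega)
  obtain ⟨X, hX, hX0⟩ := (Submodule.ne_bot_iff _).1 hker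
  have h : ∀ o, L X o = 0 := fun o => congrFun (LinearMap.mem_ker.1 hX) o
  exact ⟨X, hX0, h none, fun s => h (some s)⟩

/-- Biquard's argument for the vanishing of `γ_i` in dimensions above seven: the cyclic identity for
`X`, `I_{i+2} X` and `Z`, with `X` orthogonal to the quaternionic line of `Z`, reduces to
`g(X, X) γ_i(Z) = 0`. -/
theorem skewDefect_eq_zero (hn : 2 ≤ n) (hp : p ∈ F.U) {ξ : Fin 3 → T n p}
    (hξ : ∀ s k, F.η s p (ξ k) = if s = k then 1 else 0)
    (hd : ∀ s, ∀ X : S.H p, extD (F.η s) p (ξ s) (X : T n p) = 0) (i : Fin 3) (Z : S.H p) :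
    F.skewDefect ξ i Z = 0 := by
  obtain ⟨X, hX0, hXZ, hXI⟩ := F.exists_orthogonal hn Z
  have h := F.cyclic_identity hp hξ hd i X (F.I (i + 2) p X) Z
  have hi1 : F.I (i + 1) p (F.I (i + 2) p X) = F.I i p X := by
    have := F.I_I_succ hp (i + 1) X
    rwa [show i + 1 + 1 = i + 2 by fin_cases i <;> rfl,
      show i + 1 + 2 = i by fin_cases i <;> rfl] at this
  have hXX : S.g p (F.I i p X) X = 0 := by
    have := F.g_I_skew hp i X X
    rw [S.g_symm p X] at this
    linarith
  have hg := S.g_pos p X hX0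
  simp only [F.extD_eq_two_mul_g hp, hi1, F.I_I hp, F.g_I_skew hp _ Z, S.g_symm p Z, hXZ, hXI,
    F.g_I_skew hp _ X, map_neg, LinearMap.neg_apply] at h
  have h1 : S.g p X (F.I i p X) = 0 := by rw [S.g_symm, hXX]
  simp only [h1] at h
  have h3 : S.g p X X * F.skewDefect ξ i Z = 0 := by linarith
  exact (mul_eq_zero.1 h3).resolve_left hg.ne'

/-- A frame dual to `η` is determined up to horizontal vectors, and these can be chosen so that
`dη_s(ξ_s, ·) = 0` on `H`, because `dη_s` is nondegenerate on `H`. -/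
theorem exists_extD_self_eq_zero (hp : p ∈ F.U) : ∃ ξ : Fin 3 → T n p,
    (∀ s k, F.η s p (ξ k) = if s = k then 1 else 0) ∧
    ∀ s, ∀ X : S.H p, extD (F.η s) p (ξ s) (X : T n p) = 0 := by
  choose e he using fun k : Fin 3 => F.exists_dual hp (fun s => if s = k then 1 else 0)
  have hh : ∀ s, ∃ h : S.H p, ∀ X : S.H p,
      2 * S.g p (F.I s p h) X = -extD (F.η s) p (e s) (X : T n p) := by
    intro s
    let L : S.H p →ₗ[ℝ] Module.Dual ℝ (S.H p) := (2 : ℝ) • (S.g p ∘ₗ F.I s p)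
    have hL : Function.Injective L := by
      rw [← LinearMap.ker_eq_bot, LinearMap.ker_eq_bot']
      intro X hX
      have h1 : 2 * S.g p (F.I s p X) (F.I s p X) = 0 := LinearMap.congr_fun hX (F.I s p X)
      have h2 : F.I s p X = 0 := by
        by_contra h
        have := S.g_pos p _ h
        linarith
      rw [← neg_eq_zero, ← F.I_I hp s, h2, map_zero]
    obtain ⟨h, hh⟩ := (LinearMap.injective_iff_surjective_of_finrank_eq_finrank
      Subspace.dual_finrank_eq.symm).1 hL (-(extD (F.η s) p (e s) ∘ₗ (S.H p).subtype))
    exact ⟨h, fun X => LinearMap.congr_fun hh X⟩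
  choose h hh using hh
  refine ⟨fun k => e k + h k, fun s k => ?_, fun s X => ?_⟩
  · rw [map_add, he, (F.mem_H p hp _).1 (h k).2 s, add_zero]
  · rw [map_add, LinearMap.add_apply, F.extD_eq_two_mul_g hp, hh, add_neg_cancel]

/-- In dimensions above seven, every local contact form has Reeb vector fields. -/
theorem nonempty_reeb (hn : 2 ≤ n) : Nonempty F.Reeb := by
  classical
  choose ξ hξ hd using fun p : F.U => F.exists_extD_self_eq_zero p.2
  -- The values outside `U` are irrelevant.
  let ξ' : Fin 3 → ∀ p : M, T n p := fun k p => if hp : p ∈ F.U then ξ ⟨p, hp⟩ k else 0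
  have hξ' : ∀ (p) (hp : p ∈ F.U) (k), ξ' k p = ξ ⟨p, hp⟩ k := fun p hp k => dif_pos hp
  refine ⟨⟨ξ', fun p hp s k => ?_, fun p hp s X => ?_, fun p hp s k X => ?_⟩⟩
  · rw [hξ' p hp]
    exact hξ ⟨p, hp⟩ s k
  · rw [hξ' p hp]
    exact hd ⟨p, hp⟩ s X
  · rw [hξ' p hp, hξ' p hp]
    have hs := fun s => hd ⟨p, hp⟩ s X
    have h : ∀ i, extD (F.η (i + 2)) p (ξ ⟨p, hp⟩ (i + 1)) (X : T n p)
        + extD (F.η (i + 1)) p (ξ ⟨p, hp⟩ (i + 2)) (X : T n p) = 0 :=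
      fun i => F.skewDefect_eq_zero hn hp (hξ ⟨p, hp⟩) (hd ⟨p, hp⟩) i X
    rw [eq_neg_iff_add_eq_zero]
    have h0 := h 0
    have h1 := h 1
    have h2 := h 2
    simp only [zero_add, Fin.reduceAdd] at h0 h1 h2
    fin_cases s <;> fin_cases k
    · exact (congrArg₂ (· + ·) (hs 0) (hs 0)).trans (add_zero 0)
    · exact h2
    · exact (add_comm _ _).trans h1
    · exact (add_comm _ _).trans h2
    · exact (congrArg₂ (· + ·) (hs 1) (hs 1)).trans (add_zero 0)
    · exact h0
    · exact h1
    · exact (add_comm _ _).trans h0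
    · exact (congrArg₂ (· + ·) (hs 2) (hs 2)).trans (add_zero 0)

end Data.ContactForm

/-! ### The horizontal part of a vector field -/

namespace Data.ContactForm.Reeb

variable {S : Data n M} {F : S.ContactForm} (R : F.Reeb) {p : M} (hp : p ∈ F.U)

theorem hor_add_sum (v : T n p) : v = R.hor hp v + ∑ s, F.η s p v • R.ξ s p := by
  simp [hor]

theorem hor_coe (X : S.H p) : R.hor hp (X : T n p) = X := by
  have h := (F.mem_H p hp _).1 X.2
  exact Subtype.ext (by simp [hor, h])

theorem g_hor_sharp (θ : Module.Dual ℝ (T n p)) (X : S.H p) :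
    S.g p (R.hor hp (R.sharp hp θ)) X = θ (X : T n p) := by
  have h : R.gext hp (R.sharp hp θ) (X : T n p) = θ (X : T n p) :=
    LinearMap.BilinForm.apply_toDual_symm_apply ..
  rw [← h, gext_apply, hor_coe]
  simp [(F.mem_H p hp _).1 X.2]

/-- The horizontal part of `f_j α_k^♯ - f_k α_j^♯ - (df_i)^♯` at `p`, where
`(i, j, k) = (i, i + 1, i + 2)`; its image under `I_i` is `hamiltonian`. -/
def potential (f : Fin 3 → M → ℝ) (i : Fin 3) : S.H p :=
  f (i + 1) p • R.hor hp (R.sharp hp (R.α hp (i + 2)))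
    - f (i + 2) p • R.hor hp (R.sharp hp (R.α hp (i + 1)))
    - R.hor hp (R.sharp hp (dfun (n := n) (f i) p : T n p →ₗ[ℝ] ℝ))

theorem hamiltonian_eq (f : Fin 3 → M → ℝ) (i : Fin 3) :
    R.hamiltonian hp f i = (F.I i p (R.potential hp f i) : T n p) := by
  simp [hamiltonian, potential, Iext]

/-- The horizontal `1`-form dual to `potential`; the skewness of the Reeb conditions turns `α_k`
into `-dη_i(ξ_j, ·)`, where `(i, j, k) = (i, i + 1, i + 2)`. -/
theorem g_potential (f : Fin 3 → M → ℝ) (i : Fin 3) (X : S.H p) :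
    S.g p (R.potential hp f i) X =
      -(f (i + 1) p * extD (F.η i) p (R.ξ (i + 1) p) (X : T n p))
      - f (i + 2) p * extD (F.η i) p (R.ξ (i + 2) p) (X : T n p)
      - dfun (n := n) (f i) p (X : T n p) := by
  have hα : ∀ j, R.α hp j (X : T n p) = extD (F.η (j + 2)) p (R.ξ (j + 1) p) (X : T n p) := by
    intro j
    simp [α, hor_coe]
  have h1 := hα (i + 1)
  have h2 := hα (i + 2)
  rw [show i + 1 + 2 = i by fin_cases i <;> rfl,
    show i + 1 + 1 = i + 2 by fin_cases i <;> rfl] at h1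
  rw [show i + 2 + 2 = i + 1 by fin_cases i <;> rfl,
    show i + 2 + 1 = i by fin_cases i <;> rfl,
    R.d_skew p hp] at h2
  simp only [potential, map_sub, map_smul, LinearMap.sub_apply, LinearMap.smul_apply,
    g_hor_sharp, h1, h2, smul_eq_mul]
  simp

/-- The functions `f_s` are forced: `hamiltonian` is horizontal, so `η_s` sees only `f_s ξ_s`. -/
theorem eq_η_of_eq_hamiltonian {f : Fin 3 → M → ℝ} {i : Fin 3} {v : T n p}
    (h : v = -(1 / 2 : ℝ) • R.hamiltonian hp f i + ∑ s, f s p • R.ξ s p) (s : Fin 3) :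
    f s p = F.η s p v := by
  have h0 : F.η s p (R.hamiltonian hp f i) = 0 := by
    rw [hamiltonian_eq]
    exact (F.mem_H p hp _).1 (F.I i p (R.potential hp f i)).2 s
  rw [h, map_add, map_smul, h0]
  simp [R.η_ξ p hp]

/-- The displayed form of `Q` for the index `i` is equivalent to the vanishing of
`L_Q η_i = df_i + ι_Q dη_i` on `H`. -/
theorem eq_hamiltonian_iff {f : Fin 3 → M → ℝ} {v : T n p} (hf : ∀ s, f s p = F.η s p v)
    (i : Fin 3) :
    v = -(1 / 2 : ℝ) • R.hamiltonian hp f i + ∑ s, f s p • R.ξ s p ↔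
      ∀ X : S.H p, dfun (n := n) (f i) p (X : T n p) + extD (F.η i) p v (X : T n p) = 0 := by
  have hv := R.hor_add_sum hp v
  -- Apply `I_i` to the horizontal parts of both sides, then test against `H` with `g`.
  have h1 : v = -(1 / 2 : ℝ) • R.hamiltonian hp f i + ∑ s, f s p • R.ξ s p ↔
      (2 : ℝ) • F.I i p (R.hor hp v) = R.potential hp f i := by
    rw [hamiltonian_eq]
    simp only [hf]
    conv_lhs => lhs; rw [hv]
    rw [add_left_inj, ← Submodule.coe_smul, Subtype.coe_inj]
    constructor
    · intro h
      rw [h, map_smul, F.I_I hp]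
      module
    · intro h
      rw [← h, map_smul, F.I_I hp]
      module
  have h2 : (2 : ℝ) • F.I i p (R.hor hp v) = R.potential hp f i ↔
      ∀ X : S.H p, S.g p ((2 : ℝ) • F.I i p (R.hor hp v)) X = S.g p (R.potential hp f i) X := by
    refine ⟨fun h X => by rw [h], fun h => ?_⟩
    rw [← sub_eq_zero]
    by_contra h0
    have := S.g_pos p _ h0
    rw [map_sub (S.g p), LinearMap.sub_apply, h, sub_self] at this
    exact lt_irrefl _ this
  rw [h1, h2]
  refine forall_congr' fun X => ?_
  rw [g_potential]
  conv_rhs => rw [hv]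
  simp only [map_add, map_smul, LinearMap.add_apply,
    LinearMap.smul_apply, smul_eq_mul, F.extD_eq_two_mul_g hp, sum_fin_three_cyclic _ i,
    R.d_self p hp, hf]
  constructor <;> intro h <;> linarith

/-! ### The vertical components of the Lie derivatives -/

/-- The values `dη_i(v, ξ_s)`, split into the contributions of the horizontal and the vertical part
of `v`. -/
theorem extD_apply_ξ (i s : Fin 3) (v : T n p) :
    extD (F.η i) p v (R.ξ s p) = -extD (F.η i) p (R.ξ s p) (R.hor hp v : T n p)
      + ∑ t, F.η t p v * extD (F.η i) p (R.ξ t p) (R.ξ s p) := by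
  conv_lhs => rw [R.hor_add_sum hp v]
  simp only [map_add, map_sum, map_smul, LinearMap.add_apply, LinearMap.sum_apply,
    LinearMap.smul_apply, smul_eq_mul]
  rw [extD_swap]

include hp in
/-- The horizontal part of `v` does not contribute since `dη_i(ξ_i, ·)` vanishes on `H`. -/
theorem extD_apply_ξ_self (i : Fin 3) (v : T n p) :
    extD (F.η i) p v (R.ξ i p) =
      F.η (i + 1) p v * extD (F.η i) p (R.ξ (i + 1) p) (R.ξ i p)
      + F.η (i + 2) p v * extD (F.η i) p (R.ξ (i + 2) p) (R.ξ i p) := by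
  rw [R.extD_apply_ξ hp, R.d_self p hp, sum_fin_three_cyclic _ i, extD_self]
  ring

include hp in
/-- The horizontal part of `v` does not contribute since `dη_i(ξ_{i+1}, ·) + dη_{i+1}(ξ_i, ·)`
vanishes on `H`. -/
theorem extD_apply_ξ_add (i : Fin 3) (v : T n p) :
    extD (F.η i) p v (R.ξ (i + 1) p) + extD (F.η (i + 1)) p v (R.ξ i p) =
      F.η i p v * extD (F.η i) p (R.ξ i p) (R.ξ (i + 1) p)
      + F.η (i + 2) p v * extD (F.η i) p (R.ξ (i + 2) p) (R.ξ (i + 1) p)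
      + (F.η (i + 1) p v * extD (F.η (i + 1)) p (R.ξ (i + 1) p) (R.ξ i p)
      + F.η (i + 2) p v * extD (F.η (i + 1)) p (R.ξ (i + 2) p) (R.ξ i p)) := by
  rw [R.extD_apply_ξ hp, R.extD_apply_ξ hp (i + 1), R.d_skew p hp, sum_fin_three_cyclic _ i,
    sum_fin_three_cyclic _ i, extD_self, extD_self]
  ring

end Data.ContactForm.Reeb

section
variable {S : Data n M} {F : S.ContactForm} (R : F.Reeb) {Q : ∀ p : M, T n p}

/-- At a point, the four equations for all `i` hold if and only if the Lie derivatives `L_Q η_i`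
vanish on `H` and the matrix `(L_Q η_i)(ξ_s)` has equal diagonal entries and is skew off the diagonal. The
fourth equation follows from the first, used for `i` and for `i + 2`. -/
theorem Data.ContactForm.Reeb.equations_iff {p : M} (hp : p ∈ F.U) (hQ : SmoothFieldOn Q F.U)
    {f : Fin 3 → M → ℝ} (hf : ∀ s, f s p = F.η s p (Q p))
    (hdf : ∀ s v, dfun (n := n) (f s) p v = dfun (n := n) (fun q => F.η s q (Q q)) p v) :
    (∀ i, Q p = -(1 / 2 : ℝ) • R.hamiltonian hp f i + ∑ s, f s p • R.ξ s p ∧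
      f (i + 1) p * extD (F.η i) p (R.ξ (i + 1) p) (R.ξ i p)
          + f (i + 2) p * extD (F.η i) p (R.ξ (i + 2) p) (R.ξ i p)
          + dfun (n := n) (f i) p (R.ξ i p)
        = f (i + 2) p * extD (F.η (i + 1)) p (R.ξ (i + 2) p) (R.ξ (i + 1) p)
          + f i p * extD (F.η (i + 1)) p (R.ξ i p) (R.ξ (i + 1) p)
          + dfun (n := n) (f (i + 1)) p (R.ξ (i + 1) p) ∧
      f i p * extD (F.η i) p (R.ξ i p) (R.ξ (i + 1) p)
          + f (i + 2) p * extD (F.η i) p (R.ξ (i + 2) p) (R.ξ (i + 1) p)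
          + dfun (n := n) (f i) p (R.ξ (i + 1) p)
        = -(f (i + 1) p * extD (F.η (i + 1)) p (R.ξ (i + 1) p) (R.ξ i p))
          - f (i + 2) p * extD (F.η (i + 1)) p (R.ξ (i + 2) p) (R.ξ i p)
          - dfun (n := n) (f (i + 1)) p (R.ξ i p) ∧
      R.hamiltonian hp f i = R.hamiltonian hp f (i + 2)) ↔
    (∀ i, ∀ X : S.H p, lieD Q (F.η i) p (X : T n p) = 0) ∧
    (∀ i, lieD Q (F.η i) p (R.ξ i p) = lieD Q (F.η (i + 1)) p (R.ξ (i + 1) p)) ∧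
    ∀ i, lieD Q (F.η i) p (R.ξ (i + 1) p) = -lieD Q (F.η (i + 1)) p (R.ξ i p) := by
  have hL : ∀ i v, lieD Q (F.η i) p v = dfun (n := n) (f i) p v + extD (F.η i) p (Q p) v :=
    fun i v => (lieD_apply F.isOpen_U hp (F.η_smooth i) hQ v).trans (by rw [hdf])
  have h1 := fun i => R.eq_hamiltonian_iff hp hf i
  have h2 := fun i => R.extD_apply_ξ_self hp i (Q p)
  have h3 := fun i => R.extD_apply_ξ_add hp i (Q p)
  have e1 : ∀ i : Fin 3, i + 1 + 1 = i + 2 := by decide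
  have e2 : ∀ i : Fin 3, i + 1 + 2 = i := by decide
  simp only [hL, ← hf] at h2 h3 ⊢
  constructor
  · refine fun h => ⟨fun i => (h1 i).1 (h i).1, fun i => ?_, fun i => ?_⟩
    · have := (h i).2.1
      rw [h2, h2 (i + 1), e1, e2]
      linarith
    · have := (h i).2.2.1
      linarith [h3 i]
  · rintro ⟨g1, g2, g3⟩ i
    refine ⟨(h1 i).2 (g1 i), ?_, ?_, ?_⟩
    · have := g2 i
      rw [h2, h2 (i + 1), e1, e2] at this
      linarith
    · linarith [g3 i, h3 i]
    · have h4 := (h1 i).2 (g1 i)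
      rw [(h1 (i + 2)).2 (g1 (i + 2)), add_left_inj] at h4
      exact (smul_right_injective _ (by norm_num : -(1 / 2 : ℝ) ≠ 0) h4).symm

/-- The components `(L_Q η_i)(ξ_s)` are smooth if `L_Q η_i` vanishes on `H`: they are then equal to
`(L_Q η_i)(e_s)` for every smooth local frame `e` dual to `η`. -/
theorem Data.ContactForm.Reeb.smooth_lieD_ξ (hQ : SmoothFieldOn Q F.U)
    (h0 : ∀ p ∈ F.U, ∀ i, ∀ X : S.H p, lieD Q (F.η i) p (X : T n p) = 0) (i s : Fin 3) :
    SmoothFunOn (n := n) (fun p => lieD Q (F.η i) p (R.ξ s p)) F.U := by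
  intro p hp
  obtain ⟨W, e, hW, hpW, hWU, he, hηe⟩ := F.exists_dualFrame hp
  have h1 : SmoothFunOn (n := n) (fun q => dfun (n := n) (fun q => F.η i q (Q q)) q (e s q)
      + extD (F.η i) q (Q q) (e s q)) W :=
    (SmoothFunOn.dfun_apply hW (SmoothFormOn.apply ((F.η_smooth i).mono hWU) (hQ.mono hWU))
      (he s)).add (SmoothFormOn.extD_apply hW ((F.η_smooth i).mono hWU) (hQ.mono hWU) (he s))
  have h2 : SmoothFunOn (n := n) (fun p => lieD Q (F.η i) p (R.ξ s p)) W := by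
    refine h1.congr fun q hq => ?_
    have hqU := hWU hq
    have hmem : R.ξ s q - e s q ∈ S.H q := by
      rw [F.mem_H q hqU]
      intro k
      rw [map_sub, R.η_ξ q hqU, hηe q hq, sub_self]
    have h3 := h0 q hqU i ⟨_, hmem⟩
    rw [map_sub, sub_eq_zero] at h3
    exact h3.trans (lieD_apply F.isOpen_U hqU (F.η_smooth i) hQ _)
  exact (h2.contMDiffAt (hW.mem_nhds hpW)).contMDiffWithinAt

end
end QC
end

/-! ### QC vector fields -/

theorem mainTheorem10 {n : ℕ} (hn : 1 ≤ n) {M : Type*} [TopologicalSpace M]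
    [ChartedSpace (QC.Model n) M] [IsManifold 𝓘(ℝ, QC.Model n) ∞ M]
    (S : QC.Structure n M) (Q : ∀ p : M, QC.T n p) (hQ : QC.SmoothFieldOn Q Set.univ) :
    (S.IsQCVectorField Q ↔
      ∀ (F : S.ContactForm) (R : F.Reeb), ∃ f : Fin 3 → M → ℝ,
        (∀ i, QC.SmoothFunOn (n := n) (f i) F.U) ∧
        ∀ (p : M) (hp : p ∈ F.U), ∀ i j k : Fin 3, j = i + 1 → k = i + 2 →
          Q p = -(1 / 2 : ℝ) • R.hamiltonian hp f i + ∑ s, f s p • R.ξ s p ∧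
          f j p * QC.extD (F.η i) p (R.ξ j p) (R.ξ i p)
              + f k p * QC.extD (F.η i) p (R.ξ k p) (R.ξ i p)
              + QC.dfun (n := n) (f i) p (R.ξ i p)
            = f k p * QC.extD (F.η j) p (R.ξ k p) (R.ξ j p)
              + f i p * QC.extD (F.η j) p (R.ξ i p) (R.ξ j p)
              + QC.dfun (n := n) (f j) p (R.ξ j p) ∧
          f i p * QC.extD (F.η i) p (R.ξ i p) (R.ξ j p)
              + f k p * QC.extD (F.η i) p (R.ξ k p) (R.ξ j p)
              + QC.dfun (n := n) (f i) p (R.ξ j p)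
            = -(f j p * QC.extD (F.η j) p (R.ξ j p) (R.ξ i p))
              - f k p * QC.extD (F.η j) p (R.ξ k p) (R.ξ i p)
              - QC.dfun (n := n) (f j) p (R.ξ i p) ∧
          R.hamiltonian hp f i = R.hamiltonian hp f k) ∧
    (∀ (F : S.ContactForm) (R : F.Reeb) (f : Fin 3 → M → ℝ) (p : M) (hp : p ∈ F.U) (i : Fin 3),
      Q p = -(1 / 2 : ℝ) • R.hamiltonian hp f i + ∑ s, f s p • R.ξ s p →
        ∀ s, f s p = F.η s p (Q p)) := by
  have hmore : ∀ (F : S.ContactForm) (R : F.Reeb) (f : Fin 3 → M → ℝ) (p : M) (hp : p ∈ F.U)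
      (i : Fin 3), Q p = -(1 / 2 : ℝ) • R.hamiltonian hp f i + ∑ s, f s p • R.ξ s p →
        ∀ s, f s p = F.η s p (Q p) := fun F R f p hp i h => R.eq_η_of_eq_hamiltonian hp h
  have hQU : ∀ F : S.ContactForm, QC.SmoothFieldOn Q F.U := fun F => hQ.mono (subset_univ _)
  refine ⟨⟨fun h F R => ?_, fun h F => ?_⟩, hmore⟩
  · obtain ⟨ν, O, -, -, hO⟩ := h F
    refine ⟨fun s q => F.η s q (Q q), fun s => QC.SmoothFormOn.apply (F.η_smooth s) (hQU F), ?_⟩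
    rintro p hp i j k rfl rfl
    obtain ⟨hso, hL⟩ := hO p hp
    rw [LieAlgebra.Orthogonal.mem_so] at hso
    have hν : ∀ i s, QC.lieD Q (F.η i) p (R.ξ s p) = (if i = s then ν p else 0) + O p i s := by
      intro i s
      rw [hL]
      simp [R.η_ξ p hp]
    exact (R.equations_iff hp (hQU F) (fun _ => rfl) (fun _ _ => rfl)).2
      ⟨fun i X => by simp [hL, (F.mem_H p hp _).1 X.2], fun i => by
        have h1 := congrFun (congrFun hso i) i
        have h2 := congrFun (congrFun hso (i + 1)) (i + 1)
        simp only [Matrix.transpose_apply, Matrix.neg_apply] at h1 h2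
        rw [hν, hν, if_pos rfl, if_pos rfl]
        linarith, fun i => by
        have h1 := congrFun (congrFun hso i) (i + 1)
        simp only [Matrix.transpose_apply, Matrix.neg_apply] at h1
        rw [hν, hν, if_neg (by fin_cases i <;> decide), if_neg (by fin_cases i <;> decide), h1]
        ring⟩ i
  · obtain ⟨R⟩ : Nonempty F.Reeb := by
      rcases hn.eq_or_lt with h1 | h2
      · exact S.exists_reeb h1.symm F
      · exact F.nonempty_reeb h2
    obtain ⟨f, hf, hfe⟩ := h F R
    have hfη : ∀ s, EqOn (f s) (fun q => F.η s q (Q q)) F.U := fun s p hp =>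
      hmore F R f p hp 0 (hfe p hp 0 1 2 rfl rfl).1 s
    have key := fun p hp => (R.equations_iff hp (hQU F) (f := f) (fun s => hfη s hp)
      (fun s v => QC.dfun_congr F.isOpen_U hp (hfη s) v)).1
      (fun i => hfe p hp i _ _ rfl rfl)
    have hA := R.smooth_lieD_ξ (hQU F) (fun p hp => (key p hp).1)
    -- `ν` is the common diagonal entry of the matrix `(L_Q η_i)(ξ_s)`, and `O` is the rest.
    refine ⟨fun p => QC.lieD Q (F.η 0) p (R.ξ 0 p),
      fun p => Matrix.of fun i s => QC.lieD Q (F.η i) p (R.ξ s p)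
        - if i = s then QC.lieD Q (F.η 0) p (R.ξ 0 p) else 0, hA 0 0, fun i s => ?_,
      fun p hp => ?_⟩
    · by_cases his : i = s
      · simp only [Matrix.of_apply, if_pos his]
        exact (hA i s).sub (hA 0 0)
      · simpa only [Matrix.of_apply, if_neg his, sub_zero] using hA i s
    · obtain ⟨hH, hd, ha⟩ := key p hp
      have hd0 : ∀ i, QC.lieD Q (F.η i) p (R.ξ i p) = QC.lieD Q (F.η 0) p (R.ξ 0 p) := by
        have h0 := hd 0
        have h1 := hd 1
        intro i
        fin_cases i
        · rfl
        · exact h0.symm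
        · exact (h0.trans h1).symm
      constructor
      · rw [LieAlgebra.Orthogonal.mem_so]
        ext i s
        have h0 := ha 0
        have h1 := ha 1
        have h2 := ha 2
        have d1 := hd0 1
        have d2 := hd0 2
        simp only [zero_add, Fin.reduceAdd] at h0 h1 h2
        fin_cases i <;> fin_cases s <;> simp <;> linarith
      · intro i
        ext v
        conv_lhs => rw [R.hor_add_sum hp v]
        rw [map_add, hH, map_sum]
        simp [mul_sub, Finset.sum_sub_distrib, mul_comm]
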